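/- Let $X=\Gamma\backslash G$ be a $6$-dimensional nilmanifold, that is, the compact quotient of a simply connected nilpotent real Lie group $G$ of dimension $6$ by a discrete subgroup $\Gamma$ acting by left translations, and suppose that $X$ is not diffeomorphic to the torus $\mathbb{R}^6/\mathbb{Z}^6$. Let $J$ be a left-invariant complex structure on $X$, that is, an integrable almost complex structure whose pull-back to $G$ is invariant under left translations. For a $J$-Hermitian metric $g$ on $X$ let $\omega=g(J\cdot,\cdot)$ be its associated $(1,1)$-form. Then: (1) there is no left-invariant $J$-Hermitian metric $g$ on $X$ such that $\omega$ is the $(1,1)$-component of a $d$-closed complex $2$-form on $X$ (which need not be left-invariant); (2) for every $J$-Hermitian metric $g$ on $X$, left-invariant or not, $\omega$ is the $(1,1)$-component of a $d$-closed complex $2$-form on $X$ if and only if $g$ is Hermitian-symplectic, that is, $\omega$ is the $(1,1)$-component of a real symplectic form $\Omega$ on $X$ that tames $J$ (i.e. $\Omega(v,Jv)>0$ for all tangent vectors $v\neq 0$). -/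

import Mathlib

open Bundle VectorField
open scoped Manifold ContDiff

noncomputable section

namespace Nilmfd

/-- `X` is diffeomorphic to the standard torus `ℝ⁶/ℤ⁶`: there is a surjective local diffeomorphism
`ℝ⁶ → X` whose fibres are exactly the cosets of `ℤ⁶`. -/
def IsTorus (X : Type*) [TopologicalSpace X] [ChartedSpace (EuclideanSpace ℝ (Fin 6)) X] : Prop :=
  ∃ p : EuclideanSpace ℝ (Fin 6) → X,
    IsLocalDiffeomorph (𝓡 6) (𝓡 6) ∞ p ∧ Function.Surjective p ∧
      ∀ x y, p x = p y ↔ ∀ i, ∃ k : ℤ, y i = x i + k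

/-- The presentation of a smooth manifold `X` as the quotient `Γ\G` of a Lie group `G` by a discrete
subgroup `Γ` acting by left translations: the projection `G → X` is a surjective local
diffeomorphism whose fibres are exactly the orbits `Γ g`. (This determines the topology and
the smooth structure of `X`; if `X` is compact, then `Γ` is cocompact.) -/
structure QuotientPresentation (G X : Type*) [Group G] [TopologicalSpace G]
    [ChartedSpace (EuclideanSpace ℝ (Fin 6)) G] [TopologicalSpace X]
    [ChartedSpace (EuclideanSpace ℝ (Fin 6)) X] where
  /-- the discrete subgroup -/
  lattice : Subgroup G
  discrete : DiscreteTopology lattice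
  /-- the projection `G → Γ\G` -/
  proj : G → X
  isLocalDiffeomorph : IsLocalDiffeomorph (𝓡 6) (𝓡 6) ∞ proj
  surjective : Function.Surjective proj
  proj_eq_iff : ∀ g h, proj g = proj h ↔ ∃ γ ∈ lattice, h = γ * g

section Manifold

variable (X : Type*) [TopologicalSpace X] [ChartedSpace (EuclideanSpace ℝ (Fin 6)) X]
  [IsManifold (𝓡 6) ∞ X]

/-- Smooth vector fields on `X`. -/
structure SmoothVectorField where
  /-- the value at a point -/
  val : (x : X) → TangentSpace (𝓡 6) x
  contMDiff : ContMDiff (𝓡 6) ((𝓡 6).prod 𝓘(ℝ, EuclideanSpace ℝ (Fin 6))) ∞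
    (fun x => (TotalSpace.mk' (EuclideanSpace ℝ (Fin 6)) x (val x) : TangentBundle (𝓡 6) X))

/-- Smooth differential 2-forms on `X` with values in `F` (real forms: `F = ℝ`; complex forms:
`F = ℂ`). -/
structure TwoForm (F : Type*) [NormedAddCommGroup F] [NormedSpace ℝ F] where
  /-- the value at a point -/
  val : (x : X) → TangentSpace (𝓡 6) x →L[ℝ] TangentSpace (𝓡 6) x →L[ℝ] F
  alternating : ∀ x v, val x v v = 0
  contMDiff : ContMDiff (𝓡 6)
    ((𝓡 6).prod 𝓘(ℝ, EuclideanSpace ℝ (Fin 6) →L[ℝ] EuclideanSpace ℝ (Fin 6) →L[ℝ] F)) ∞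
    (fun x => TotalSpace.mk' (EuclideanSpace ℝ (Fin 6) →L[ℝ] EuclideanSpace ℝ (Fin 6) →L[ℝ] F)
      (E := fun x : X => TangentSpace (𝓡 6) x →L[ℝ] TangentSpace (𝓡 6) x →L[ℝ] F) x (val x))

/-- A complex structure on `X`, as an integrable almost complex structure: a smooth endomorphism
field `J` of the tangent bundle with `J² = -1` and vanishing Nijenhuis tensor. -/
structure ComplexStructure where
  /-- the value at a point -/
  J : (x : X) → TangentSpace (𝓡 6) x →L[ℝ] TangentSpace (𝓡 6) x
  J_J : ∀ x v, J x (J x v) = -v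
  contMDiff : ContMDiff (𝓡 6)
    ((𝓡 6).prod 𝓘(ℝ, EuclideanSpace ℝ (Fin 6) →L[ℝ] EuclideanSpace ℝ (Fin 6))) ∞
    (fun x => TotalSpace.mk' (EuclideanSpace ℝ (Fin 6) →L[ℝ] EuclideanSpace ℝ (Fin 6))
      (E := fun x : X => TangentSpace (𝓡 6) x →L[ℝ] TangentSpace (𝓡 6) x) x (J x))
  integrable : ∀ (V W : SmoothVectorField X) (x : X),
    mlieBracket (𝓡 6) (fun y => J y (V.val y)) (fun y => J y (W.val y)) x
      - J x (mlieBracket (𝓡 6) (fun y => J y (V.val y)) W.val x)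
      - J x (mlieBracket (𝓡 6) V.val (fun y => J y (W.val y)) x)
      - mlieBracket (𝓡 6) V.val W.val x = 0

variable {X}

/-- The exterior derivative of a 2-form, evaluated on vector fields:
`dβ(U,V,W) = U β(V,W) - V β(U,W) + W β(U,V) - β([U,V],W) + β([U,W],V) - β([V,W],U)`. -/
def TwoForm.d {F : Type*} [NormedAddCommGroup F] [NormedSpace ℝ F] (β : TwoForm X F)
    (U V W : SmoothVectorField X) (x : X) : F :=
  mvfderiv (𝓡 6) (fun y => β.val y (V.val y) (W.val y)) x (U.val x)
    - mvfderiv (𝓡 6) (fun y => β.val y (U.val y) (W.val y)) x (V.val x)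
    + mvfderiv (𝓡 6) (fun y => β.val y (U.val y) (V.val y)) x (W.val x)
    - β.val x (mlieBracket (𝓡 6) U.val V.val x) (W.val x)
    + β.val x (mlieBracket (𝓡 6) U.val W.val x) (V.val x)
    - β.val x (mlieBracket (𝓡 6) V.val W.val x) (U.val x)

/-- The 2-form `β` is `d`-closed. -/
def TwoForm.IsClosed {F : Type*} [NormedAddCommGroup F] [NormedSpace ℝ F] (β : TwoForm X F) :
    Prop :=
  ∀ (U V W : SmoothVectorField X) (x : X), β.d U V W x = 0

/-- The (1,1)-component of a 2-form with respect to `J`, at the point `x`: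
`β^{1,1}(u,v) = (β(u,v) + β(Ju,Jv)) / 2`. Indeed `β(J·,J·)` equals `β` on forms of type (1,1), and
`-β` on forms of type (2,0) and (0,2). -/
def TwoForm.component11 {F : Type*} [NormedAddCommGroup F] [NormedSpace ℝ F] (β : TwoForm X F)
    (J : ComplexStructure X) (x : X) (u v : TangentSpace (𝓡 6) x) : F :=
  (1 / 2 : ℝ) • (β.val x u v + β.val x (J.J x u) (J.J x v))

/-- A Hermitian metric on the complex manifold `(X, J)`: a smooth Riemannian metric for which `J`
is orthogonal. -/
structure HermitianMetric (J : ComplexStructure X) where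
  /-- the underlying Riemannian metric -/
  metric : ContMDiffRiemannianMetric (𝓡 6) ∞ (EuclideanSpace ℝ (Fin 6))
    (fun x : X => TangentSpace (𝓡 6) x)
  hermitian : ∀ x u v, metric.inner x (J.J x u) (J.J x v) = metric.inner x u v

/-- The (1,1)-form associated to a Hermitian metric, `ω(u,v) = g(Ju,v)`. -/
def HermitianMetric.omega {J : ComplexStructure X} (g : HermitianMetric J) (x : X)
    (u v : TangentSpace (𝓡 6) x) : ℝ :=
  g.metric.inner x (J.J x u) v

/-- `ω` is the (1,1)-component of a `d`-closed (complex) 2-form on `X`. -/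
def HermitianMetric.IsComponentOfClosed {J : ComplexStructure X} (g : HermitianMetric J) : Prop :=
  ∃ β : TwoForm X ℂ, β.IsClosed ∧ ∀ x u v, (g.omega x u v : ℂ) = β.component11 J x u v

/-- The metric is Hermitian-symplectic: there is a real symplectic form `Ω` on `X` taming `J`
(nondegeneracy follows from taming) whose (1,1)-component is `ω`. -/
def HermitianMetric.IsHermitianSymplectic {J : ComplexStructure X} (g : HermitianMetric J) : Prop :=
  ∃ Ω : TwoForm X ℝ, Ω.IsClosed ∧ (∀ x v, v ≠ 0 → 0 < Ω.val x v (J.J x v)) ∧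
    ∀ x u v, g.omega x u v = Ω.component11 J x u v

section Invariant

variable {G : Type*} [Group G] [TopologicalSpace G] [ChartedSpace (EuclideanSpace ℝ (Fin 6)) G]

/-- The image in `T_{π(g)} X` of the value at `g ∈ G` of the left-invariant vector field on `G`
generated by `v ∈ T₁G`. For fixed `g` this is an isomorphism `T₁G → T_{π(g)} X`. -/
def QuotientPresentation.frame (N : QuotientPresentation G X) (v : GroupLieAlgebra (𝓡 6) G)
    (g : G) : TangentSpace (𝓡 6) (N.proj g) :=
  mfderiv (𝓡 6) (𝓡 6) N.proj g (mulInvariantVectorField v g)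

/-- The complex structure is left-invariant: its pull-back to `G` is invariant under left
translations, that is, it has a constant matrix in every left-invariant frame. -/
def QuotientPresentation.LeftInvariant (N : QuotientPresentation G X) (J : ComplexStructure X) :
    Prop :=
  ∃ j : GroupLieAlgebra (𝓡 6) G → GroupLieAlgebra (𝓡 6) G, ∀ v g,
    J.J (N.proj g) (N.frame v g) = N.frame (j v) g

/-- The metric is left-invariant: its pull-back to `G` is invariant under left translations, that
is, any two left-invariant vector fields have a constant inner product. -/
def QuotientPresentation.LeftInvariantMetric (N : QuotientPresentation G X)
    {J : ComplexStructure X} (h : HermitianMetric J) : Prop :=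
  ∀ (u v : GroupLieAlgebra (𝓡 6) G) (g : G),
    h.metric.inner (N.proj g) (N.frame u g) (N.frame v g) =
      h.metric.inner (N.proj 1) (N.frame u 1) (N.frame v 1)

end Invariant

end Manifold

end Nilmfd

end

open scoped Topology commutatorElement BoundedContinuousFunction

/-! Part (2) is pointwise linear algebra. Since ω is real, the real part of a closed complex form
with (1,1)-component ω is a closed real form Ω with the same (1,1)-component. The (2,0)+(0,2)-part
of Ω vanishes on (v, Jv), so Ω(v, Jv) = g(Jv, Jv) > 0 and taming is automatic.

For part (1), suppose an invariant g comes from such an Ω, which need not be invariant. Replace Ω by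
an average on the Lie algebra, taken with an invariant mean on bounded continuous functions on G;
such a mean exists because nilpotent groups are amenable
(`exists_invariant_functional_of_isNilpotent`). Left-invariant fields differentiate along right
translations, so the mean kills their derivatives and `dΩ = 0` becomes the cocycle identity on the
Lie algebra. Taming survives because invariance of g makes Ω(v, Jv) constant for every
left-invariant v; positivity of the mean is not needed.

A nilpotent Lie algebra with an integrable j tamed by a closed form is abelian
(`LieAlgebra.lie_eq_zero_of_taming`): the centre is j-stable, and closedness then forces every
central bracket z to satisfy Ω(z, jz) = 0. Hence the connected group G is commutative, its
exponential map is a surjective local diffeomorphism from ℝ⁶, and compactness makes the preimage of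
Γ a full lattice. Thus X is a torus, a contradiction. -/

/-! ### Tamed complex structures on nilpotent Lie algebras -/

theorem LieAlgebra.lie_eq_zero_of_taming {L : Type*} [LieRing L] [LieAlgebra ℝ L]
    [LieRing.IsNilpotent L] (j : L → L) (hj : ∀ v, j (j v) = -v)
    (hint : ∀ v w, ⁅j v, j w⁆ - j ⁅j v, w⁆ - j ⁅v, j w⁆ - ⁅v, w⁆ = 0)
    (Ω : L →ₗ[ℝ] L →ₗ[ℝ] ℝ) (halt : ∀ v, Ω v v = 0)
    (hclosed : ∀ u v w, Ω ⁅u, v⁆ w - Ω ⁅u, w⁆ v + Ω ⁅v, w⁆ u = 0)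
    (htame : ∀ v, v ≠ 0 → 0 < Ω v (j v)) (v w : L) : ⁅v, w⁆ = 0 := by
  have hskew : ∀ v w, Ω v w = -Ω w v := fun v w => by
    have := halt (v + w)
    simp only [map_add, LinearMap.add_apply, halt] at this
    linarith
  have hj0 : j 0 = 0 := by
    by_contra h
    have h1 := htame _ h
    rw [hj] at h1
    simp at h1
  have hzero : ∀ v, Ω v (j v) = 0 → v = 0 := fun v h => by
    by_contra h'
    exact (htame v h').ne' h
  obtain ⟨n, hn⟩ :=
    (LieModule.isNilpotent_iff_exists_ucs_eq_top ℝ (L := L) (M := L)).1 inferInstance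
  set Z : ℕ → LieSubmodule ℝ L L := fun k => (⊥ : LieSubmodule ℝ L L).ucs k with hZ
  have hZ0 : ∀ v, v ∈ Z 0 ↔ v = 0 := fun v => by simp [hZ]
  have hZs : ∀ k v, v ∈ Z (k + 1) ↔ ∀ w : L, ⁅w, v⁆ ∈ Z k := fun k v => by
    simp only [hZ, LieSubmodule.ucs_succ, LieSubmodule.mem_normalizer]
  have hZl : ∀ k v w, v ∈ Z (k + 1) → ⁅v, w⁆ ∈ Z k := fun k v w h => by
    rw [← lie_skew]; exact neg_mem ((hZs k v).1 h w)
  -- The centre is j-stable. For central x, integrability says that D = ad(jx) commutes with j.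
  have hcent : ∀ x, (∀ v : L, ⁅x, v⁆ = 0) → ∀ v : L, ⁅j x, v⁆ = 0 := by
    intro x hx
    have hD : ∀ v : L, ⁅j x, j v⁆ = j ⁅j x, v⁆ := fun v => by
      have := hint x v
      rw [hx, hx, hj0, sub_zero, sub_zero] at this
      exact sub_eq_zero.1 this
    -- Closedness on (jx, u, jDu) and on (jx, Du, ju), with D²u = 0, gives 2Ω(Du, jDu) = -Ω(D[u,
    -- ju], jx), since D is a derivation commuting with j. The right side vanishes by assumption, so
    -- taming yields Du = 0.
    have key : ∀ u : L, ⁅j x, ⁅j x, u⁆⁆ = 0 → ⁅j x, ⁅u, j u⁆⁆ = 0 → ⁅j x, u⁆ = 0 := by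
      intro u h1 h2
      apply hzero
      have e1 := hclosed (j x) u (j ⁅j x, u⁆)
      have e2 := hclosed (j x) ⁅j x, u⁆ (j u)
      rw [hD, h1, hj0] at e1
      rw [hD, h1] at e2
      rw [leibniz_lie, hD] at h2
      simp only [map_zero, LinearMap.zero_apply] at e1 e2
      have e3 : Ω ⁅u, j ⁅j x, u⁆⁆ (j x) + Ω ⁅⁅j x, u⁆, j u⁆ (j x) = 0 := by
        rw [← LinearMap.add_apply, ← map_add, add_comm, h2, map_zero, LinearMap.zero_apply]
      have := hskew (j ⁅j x, u⁆) ⁅j x, u⁆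
      linarith
    have hall : ∀ k v, v ∈ Z k → ⁅j x, v⁆ = 0 := by
      intro k
      induction k with
      | zero => intro v hv; rw [(hZ0 v).1 hv, lie_zero]
      | succ k ih =>
        intro v hv
        exact key v (ih _ ((hZs k v).1 hv _)) (ih _ (hZl k v _ hv))
    exact fun v => hall n v (by simp only [hZ, hn]; trivial)
  -- If z = [v, w] is central then so is jz, and closedness on (v, w, jz) reduces to Ω(z, jz) = 0.
  have hab : ∀ k, (∀ v ∈ Z k, ∀ w : L, ⁅v, w⁆ = 0) := by
    intro k
    induction k with
    | zero => intro v hv w; rw [(hZ0 v).1 hv, zero_lie]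
    | succ k ih =>
      intro v hv w
      have hz := ih _ (hZl k v w hv)
      have hjz := hcent _ hz
      apply hzero
      have := hclosed v w (j ⁅v, w⁆)
      rw [← lie_skew v (j _), ← lie_skew w (j _), hjz, hjz] at this
      simpa using this
  exact hab n v (by simp only [hZ, hn]; trivial) w

/-! ### Amenability of nilpotent groups -/

/-- Markov–Kakutani along the upper central series: the norm-one functionals attaining the norm of e
and invariant under its k-th term form a weak-* compact set, shown nonempty by induction on k. The
base case is Hahn–Banach. In the inductive step, elements of the next term commute with everything
modulo the current one, so Cesàro means along their powers produce approximate invariance, which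
compactness makes exact. -/
theorem exists_invariant_functional_of_isNilpotent {G : Type*} [Group G] [Group.IsNilpotent G]
    {E : Type*} [NormedAddCommGroup E] [NormedSpace ℝ E] (ρ : G →* (E →L[ℝ] E))
    (hρ : ∀ g x, ‖ρ g x‖ ≤ ‖x‖) (e : E) (he : e ≠ 0) (hfix : ∀ g, ρ g e = e) :
    ∃ φ : E →L[ℝ] ℝ, φ e = 1 ∧ ∀ g x, φ (ρ g x) = φ x := by
  set K : ℕ → Set (WeakDual ℝ E) := fun k => {φ | (∀ x, |φ x| ≤ ‖x‖) ∧ φ e = ‖e‖ ∧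
    ∀ g ∈ Subgroup.upperCentralSeries G k, ∀ x, φ (ρ g x) = φ x} with hK
  have hcont : ∀ x : E, Continuous fun φ : WeakDual ℝ E => φ x := WeakDual.eval_continuous
  have hcl : ∀ k, IsClosed (K k) := fun k => by
    simp only [hK, Set.ofPred_and, Set.ofPred_forall]
    refine ((isClosed_iInter fun x => isClosed_le (hcont x).abs continuous_const)).inter
      ((isClosed_eq (hcont e) continuous_const).inter ?_)
    exact isClosed_iInter fun g => isClosed_iInter fun _ => isClosed_iInter fun x =>
      isClosed_eq (hcont _) (hcont _)
  have hcomp : ∀ k, IsCompact (K k) := fun k =>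
    (WeakDual.isCompact_closedBall (𝕜 := ℝ) (E := E) 0 1).of_isClosed_subset (hcl k) fun φ hφ => by
      simp only [Set.mem_preimage, Metric.mem_closedBall, dist_zero_right]
      exact ContinuousLinearMap.opNorm_le_bound _ zero_le_one fun x => by
        rw [one_mul]; exact hφ.1 x
  have hne : ∀ k, (K k).Nonempty := by
    intro k
    induction k with
    | zero =>
      obtain ⟨φ, h1, h2⟩ := exists_dual_vector ℝ e (norm_ne_zero_iff.2 he)
      refine ⟨StrongDual.toWeakDual φ, fun x => ?_, h2, fun g hg x => ?_⟩
      · exact (φ.le_opNorm x).trans (by rw [h1, one_mul])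
      · rw [Subgroup.upperCentralSeries_zero, Subgroup.mem_bot] at hg
        simp [hg]
    | succ k ih =>
      set T := Subgroup.upperCentralSeries G (k + 1) × ℕ
      -- The bound is the telescoping error of a Cesàro mean of n + 1 terms; it tends to 0 with n,
      -- so lying in every S (g, n) means invariance under g.
      set S : T → Set (WeakDual ℝ E) := fun p =>
        {φ | ∀ x, |φ (ρ p.1 x) - φ x| ≤ 2 * ‖x‖ / (p.2 + 1)} with hS
      have hScl : ∀ p, IsClosed (S p) := fun p => by
        simp only [hS, Set.ofPred_forall]
        exact isClosed_iInter fun x =>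
          isClosed_le ((hcont _).sub (hcont _)).abs continuous_const
      have hfin : ∀ u : Finset T, (K k ∩ ⋂ i ∈ u, S i).Nonempty := by
        classical
        intro u
        induction u using Finset.induction_on with
        | empty => simpa using ih
        | insert p u _ ihu =>
          obtain ⟨φ, ⟨hφ1, hφ2, hφ3⟩, hφ4⟩ := ihu
          obtain ⟨⟨g, hg⟩, n⟩ := p
          have hn : (0 : ℝ) < n + 1 := by positivity
          let ψ : E →L[ℝ] ℝ := (n + 1 : ℝ)⁻¹ • ∑ i ∈ Finset.range (n + 1),
            (WeakDual.toStrongDual φ).comp (ρ (g ^ i))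
          have hψ : ∀ x, ψ x = (n + 1 : ℝ)⁻¹ * ∑ i ∈ Finset.range (n + 1), φ (ρ (g ^ i) x) :=
            fun x => by simp [ψ]
          have havg : ∀ (f : ℕ → ℝ) (C : ℝ), (∀ i, |f i| ≤ C) →
              |(n + 1 : ℝ)⁻¹ * ∑ i ∈ Finset.range (n + 1), f i| ≤ C := fun f C hf => by
            rw [abs_mul, abs_of_pos (inv_pos.2 hn), inv_mul_le_iff₀ hn]
            refine (Finset.abs_sum_le_sum_abs _ _).trans
              ((Finset.sum_le_sum fun i _ => hf i).trans ?_)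
            simp
          have hmul : ∀ a b x, ρ a (ρ b x) = ρ (a * b) x := fun a b x => by rw [map_mul]; rfl
          refine ⟨StrongDual.toWeakDual ψ, ⟨fun x => ?_, ?_, fun z hz x => ?_⟩, ?_⟩
          · change |ψ x| ≤ _
            rw [hψ]
            exact havg _ _ fun i => (hφ1 _).trans (hρ _ _)
          · change ψ e = _
            rw [hψ]
            simp only [hfix, hφ2, Finset.sum_const, Finset.card_range, nsmul_eq_mul]
            push_cast
            field_simp
          · change ψ _ = ψ _
            rw [hψ, hψ]
            congr 1
            refine Finset.sum_congr rfl fun i _ => ?_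
            -- Averaging keeps the invariance already obtained, because the k-th term is normal: gⁱz
            -- = (gⁱzg⁻ⁱ)gⁱ.
            rw [← hφ3 (g ^ i * z * (g ^ i)⁻¹) (Subgroup.Normal.conj_mem inferInstance z hz _)
              (ρ (g ^ i) x), hmul, hmul]
            congr 3
            group
          · simp only [Finset.mem_insert, Set.mem_iInter, forall_eq_or_imp] at hφ4 ⊢
            refine ⟨fun x => ?_, fun q hq x => ?_⟩
            · change |ψ (ρ g x) - ψ x| ≤ 2 * ‖x‖ / (n + 1)
              rw [hψ, hψ, ← mul_sub, ← Finset.sum_sub_distrib]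
              have : ∑ i ∈ Finset.range (n + 1), (φ (ρ (g ^ i) (ρ g x)) - φ (ρ (g ^ i) x)) =
                  φ (ρ (g ^ (n + 1)) x) - φ x := by
                simp_rw [hmul, ← pow_succ]
                rw [Finset.sum_range_sub fun i => φ (ρ (g ^ i) x)]
                simp
              rw [this, abs_mul, abs_of_pos (inv_pos.2 hn), inv_mul_eq_div]
              gcongr
              calc _ ≤ |φ (ρ (g ^ (n + 1)) x)| + |φ x| := abs_sub _ _
                _ ≤ ‖x‖ + ‖x‖ := add_le_add ((hφ1 _).trans (hρ _ _)) (hφ1 _)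
                _ = _ := by ring
            · change |ψ (ρ q.1 x) - ψ x| ≤ 2 * ‖x‖ / (q.2 + 1)
              rw [hψ, hψ, ← mul_sub, ← Finset.sum_sub_distrib]
              refine havg _ _ fun i => ?_
              -- The commutator lies in the k-th term, so φ does not distinguish gⁱq from qgⁱ. Hence
              -- the earlier estimates for q survive averaging over g.
              have h1 := hφ3 ⁅g ^ i, (q.1 : G)⁆
                (Subgroup.mem_upperCentralSeries_succ_iff.1 (pow_mem hg i) _)
                (ρ q.1 (ρ (g ^ i) x))
              rw [hmul, hmul, show ⁅g ^ i, (q.1 : G)⁆ * q.1 * g ^ i = g ^ i * q.1 by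
                rw [commutatorElement_def]; group, ← hmul] at h1
              rw [h1]
              refine (hφ4 q hq (ρ (g ^ i) x)).trans ?_
              gcongr
              exact hρ _ _
      obtain ⟨φ, ⟨hφ1, hφ2, -⟩, hφ⟩ := (hcomp k).inter_iInter_nonempty S hScl hfin
      refine ⟨φ, hφ1, hφ2, fun g hg x => ?_⟩
      rw [Set.mem_iInter] at hφ
      have hlim : Filter.Tendsto (fun n : ℕ => 2 * ‖x‖ * (1 / ((n : ℝ) + 1)))
          Filter.atTop (nhds 0) := by
        simpa using tendsto_one_div_add_atTop_nhds_zero_nat.const_mul (2 * ‖x‖)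
      have : |φ (ρ g x) - φ x| ≤ 0 := ge_of_tendsto' hlim fun n : ℕ =>
        (hφ (⟨g, hg⟩, n) x).trans_eq (mul_one_div _ _).symm
      exact sub_eq_zero.1 (abs_nonpos_iff.1 this)
  obtain ⟨n, hn⟩ := Group.IsNilpotent.nilpotent G
  obtain ⟨φ, -, h2, h3⟩ := hne n
  refine ⟨‖e‖⁻¹ • WeakDual.toStrongDual φ, ?_, fun g x => ?_⟩
  · change ‖e‖⁻¹ * φ e = 1
    rw [h2, inv_mul_cancel₀ (norm_ne_zero_iff.2 he)]
  · change ‖e‖⁻¹ * φ _ = ‖e‖⁻¹ * φ _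
    rw [h3 g (by rw [hn]; trivial)]

/-! ### Changing the values of a 2-form, and part (2) -/

theorem ContMDiffAt.clm_postcomp_postcomp {E H M A F F' : Type*} [NormedAddCommGroup E]
    [NormedSpace ℝ E] [TopologicalSpace H] {I : ModelWithCorners ℝ E H} [TopologicalSpace M]
    [ChartedSpace H M] [NormedAddCommGroup A] [NormedSpace ℝ A] [NormedAddCommGroup F]
    [NormedSpace ℝ F] [NormedAddCommGroup F'] [NormedSpace ℝ F'] {n : ℕ∞ω}
    {f : M → A →L[ℝ] A →L[ℝ] F} {x : M} (hf : ContMDiffAt I 𝓘(ℝ, A →L[ℝ] A →L[ℝ] F) n f x)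
    (L : F →L[ℝ] F') :
    ContMDiffAt I 𝓘(ℝ, A →L[ℝ] A →L[ℝ] F') n (fun y => (L.postcomp A).comp (f y)) x := by
  have h1 : ContMDiffAt I 𝓘(ℝ, (A →L[ℝ] F) →L[ℝ] (A →L[ℝ] F')) n
    (fun _ : M => ContinuousLinearMap.compL ℝ A F F' L) x := contMDiffAt_const
  exact h1.clm_comp hf

set_option synthInstance.maxHeartbeats 200000 in
theorem contMDiff_hom_hom_postcomp {E : Type*} [NormedAddCommGroup E] [NormedSpace ℝ E]
    {X : Type*} [TopologicalSpace X] [ChartedSpace E X] [IsManifold 𝓘(ℝ, E) ∞ X]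
    {F F' : Type*} [NormedAddCommGroup F] [NormedSpace ℝ F]
    [NormedAddCommGroup F'] [NormedSpace ℝ F'] (L : F →L[ℝ] F')
    (β : (x : X) → TangentSpace 𝓘(ℝ, E) x →L[ℝ] TangentSpace 𝓘(ℝ, E) x →L[ℝ] F)
    (hβ : ContMDiff 𝓘(ℝ, E) (𝓘(ℝ, E).prod 𝓘(ℝ, E →L[ℝ] E →L[ℝ] F)) ∞
      (fun x => TotalSpace.mk' (E →L[ℝ] E →L[ℝ] F)
        (E := fun x : X => TangentSpace 𝓘(ℝ, E) x →L[ℝ] TangentSpace 𝓘(ℝ, E) x →L[ℝ] F) x (β x))) :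
    ContMDiff 𝓘(ℝ, E) (𝓘(ℝ, E).prod 𝓘(ℝ, E →L[ℝ] E →L[ℝ] F')) ∞
      (fun x => TotalSpace.mk' (E →L[ℝ] E →L[ℝ] F')
        (E := fun x : X => TangentSpace 𝓘(ℝ, E) x →L[ℝ] TangentSpace 𝓘(ℝ, E) x →L[ℝ] F') x
        ((L.postcomp (TangentSpace 𝓘(ℝ, E) x)).comp (β x))) := by
  intro x
  have h := (contMDiffAt_hom_bundle _).1 (hβ x)
  refine (contMDiffAt_hom_bundle _).2 ⟨h.1, ?_⟩
  have := h.2.clm_postcomp_postcomp L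
  have hbase : (trivializationAt E (TangentSpace 𝓘(ℝ, E)) x).baseSet ∈ nhds x :=
    (trivializationAt E (TangentSpace 𝓘(ℝ, E)) x).open_baseSet.mem_nhds
      (FiberBundle.mem_baseSet_trivializationAt' x)
  refine this.congr_of_eventuallyEq (Filter.mem_of_superset hbase fun y hy => ?_)
  refine ContinuousLinearMap.ext fun u => ContinuousLinearMap.ext fun v => ?_
  have e1 := inCoordinates_apply_eq₂ (𝕜 := ℝ) (E₁ := fun x : X => TangentSpace 𝓘(ℝ, E) x)
    (E₂ := fun x : X => TangentSpace 𝓘(ℝ, E) x) (E₃ := Bundle.Trivial X F) (F₃ := F)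
    (ϕ := β y) (v := u) (w := v) hy hy (Set.mem_univ y)
  have e2 := inCoordinates_apply_eq₂ (𝕜 := ℝ) (E₁ := fun x : X => TangentSpace 𝓘(ℝ, E) x)
    (E₂ := fun x : X => TangentSpace 𝓘(ℝ, E) x) (E₃ := Bundle.Trivial X F') (F₃ := F')
    (ϕ := (L.postcomp (TangentSpace 𝓘(ℝ, E) y)).comp (β y)) (v := u) (w := v) hy hy
    (Set.mem_univ y)
  refine e2.trans ?_
  refine Eq.trans ?_ (congrArg L e1).symm
  simp

namespace Nilmfd

section TwoForm

variable {X : Type*} [TopologicalSpace X] [ChartedSpace (EuclideanSpace ℝ (Fin 6)) X]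
  [IsManifold (𝓡 6) ∞ X] {F F' : Type*} [NormedAddCommGroup F] [NormedSpace ℝ F]
  [NormedAddCommGroup F'] [NormedSpace ℝ F']

theorem TwoForm.contMDiff_apply (β : TwoForm X F) (U V : SmoothVectorField X) :
    ContMDiff (𝓡 6) 𝓘(ℝ, F) ∞ fun x => β.val x (U.val x) (V.val x) := by
  have := ContMDiff.clm_bundle_apply₂ (IB := 𝓡 6) (IM := 𝓡 6) (n := ∞) (b := fun x : X => x)
    (E₁ := fun x : X => TangentSpace (𝓡 6) x) (E₂ := fun x : X => TangentSpace (𝓡 6) x)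
    (E₃ := Bundle.Trivial X F) (F₃ := F) (ψ := β.val) β.contMDiff U.contMDiff V.contMDiff
  intro x
  exact (contMDiffAt_totalSpace.1 (this x)).2

theorem TwoForm.mdifferentiableAt_apply (β : TwoForm X F) (U V : SmoothVectorField X) (x : X) :
    MDifferentiableAt (𝓡 6) 𝓘(ℝ, F) (fun x => β.val x (U.val x) (V.val x)) x :=
  (β.contMDiff_apply U V).mdifferentiableAt (by simp)

/-- The composition of a 2-form with a linear map of the values. -/
noncomputable def TwoForm.map (L : F →L[ℝ] F') (β : TwoForm X F) : TwoForm X F' where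
  val x := (L.postcomp (TangentSpace (𝓡 6) x)).comp (β.val x)
  alternating x v := by simp [β.alternating]
  contMDiff := contMDiff_hom_hom_postcomp L β.val β.contMDiff

@[simp] theorem TwoForm.map_val (L : F →L[ℝ] F') (β : TwoForm X F) (x : X)
    (u v : TangentSpace (𝓡 6) x) : (β.map L).val x u v = L (β.val x u v) := rfl

theorem TwoForm.map_d (L : F →L[ℝ] F') (β : TwoForm X F) (U V W : SmoothVectorField X) (x : X) :
    (β.map L).d U V W x = L (β.d U V W x) := by
  have h : ∀ A B C : SmoothVectorField X,
      mvfderiv (𝓡 6) (fun y => L (β.val y (A.val y) (B.val y))) x (C.val x) =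
        L (mvfderiv (𝓡 6) (fun y => β.val y (A.val y) (B.val y)) x (C.val x)) := fun A B C => by
    have h1 := mfderiv_comp x (I := 𝓡 6) (L.mdifferentiableAt)
      (β.mdifferentiableAt_apply A B x)
    rw [ContinuousLinearMap.mfderiv_eq] at h1
    exact congrArg (fun T => T (C.val x)) h1
  simp only [TwoForm.d, map_val, h, map_add, map_sub]

theorem TwoForm.IsClosed.map (L : F →L[ℝ] F') {β : TwoForm X F} (h : β.IsClosed) :
    (β.map L).IsClosed := fun U V W x => by rw [β.map_d, h, map_zero]

/-- Only the (1,1)-part of Ω sees the pair (v, Jv), as skew-symmetry gives Ω(Jv, J(Jv)) = Ω(v, Jv).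
This is what makes taming automatic. -/
theorem HermitianMetric.apply_J_of_component11 {J : ComplexStructure X} (g : HermitianMetric J)
    {Ω : TwoForm X ℝ} (h : ∀ x u v, g.omega x u v = Ω.component11 J x u v) (x : X)
    (v : TangentSpace (𝓡 6) x) :
    Ω.val x v (J.J x v) = g.metric.inner x (J.J x v) (J.J x v) := by
  have h1 := h x v (J.J x v)
  rw [TwoForm.component11, J.J_J, map_neg] at h1
  have h2 := Ω.alternating x (v + J.J x v)
  simp only [map_add, _root_.add_apply, Ω.alternating] at h2
  have h3 : Ω.val x (J.J x v) v = - Ω.val x v (J.J x v) := by linarith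
  rw [h3, smul_eq_mul, HermitianMetric.omega] at h1
  linarith

theorem HermitianMetric.isComponentOfClosed_iff {J : ComplexStructure X} (g : HermitianMetric J) :
    g.IsComponentOfClosed ↔ g.IsHermitianSymplectic := by
  constructor
  · rintro ⟨β, hβ, h⟩
    have h' : ∀ x u v, g.omega x u v = (β.map Complex.reCLM).component11 J x u v := fun x u v => by
      have := congrArg Complex.re (h x u v)
      simpa [TwoForm.component11, mul_add] using this
    refine ⟨β.map Complex.reCLM, hβ.map _, fun x v hv => ?_, h'⟩
    rw [g.apply_J_of_component11 h']
    refine g.metric.pos x _ fun h0 => hv ?_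
    rw [← neg_eq_zero, ← J.J_J x v, h0, map_zero]
  · rintro ⟨Ω, hΩ, -, h⟩
    refine ⟨Ω.map Complex.ofRealCLM, hΩ.map _, fun x u v => ?_⟩
    rw [h]
    simp [TwoForm.component11, mul_add]

end TwoForm

end Nilmfd

/-! ### The adjoint action in a chart and its derivative -/

section Calculus

variable {E F : Type*} [NormedAddCommGroup E] [NormedSpace ℝ E] [NormedAddCommGroup F]
  [NormedSpace ℝ F]

theorem ContDiffAt.eventually_fderiv_partial_snd {f : E × E → F} {p : E}
    (hf : ContDiffAt ℝ 2 f (p, p)) :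
    ∀ᶠ a in 𝓝 p, ∀ w, fderiv ℝ (fun b => f (a, b)) p w = fderiv ℝ f (a, p) (0, w) := by
  have h1 : ∀ᶠ q in 𝓝 (p, p), DifferentiableAt ℝ f q :=
    (hf.eventually (by simp)).mono fun q hq => hq.differentiableAt (by simp)
  have h2 : Filter.Tendsto (fun a => (a, p)) (𝓝 p) (𝓝 (p, p)) :=
    (continuous_id.prodMk continuous_const).tendsto' _ _ rfl
  filter_upwards [h2.eventually h1] with a ha w
  have := ha.hasFDerivAt.comp p ((hasFDerivAt_const a p).prodMk (hasFDerivAt_id p))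
  exact congrArg (fun T : E →L[ℝ] F => T w) this.fderiv

theorem ContDiffAt.hasFDerivAt_fderiv_apply {f : E × E → F} {p : E} {γ : E → E × E}
    {γ' : E →L[ℝ] E × E} (hf : ContDiffAt ℝ 2 f (p, p)) (hγ : HasFDerivAt γ γ' p)
    (hγp : γ p = (p, p)) {u : E → E × E} {u' : E →L[ℝ] E × E} (hu : HasFDerivAt u u' p) :
    HasFDerivAt (fun a => fderiv ℝ f (γ a) (u a))
      ((fderiv ℝ f (p, p)).comp u' + ((fderiv ℝ (fderiv ℝ f) (p, p)).comp γ').flip (u p)) p := by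
  have h1 : HasFDerivAt (fderiv ℝ f) (fderiv ℝ (fderiv ℝ f) (p, p)) (γ p) := by
    rw [hγp]
    exact ((hf.fderiv_right (m := 1) (by norm_num)).differentiableAt (by simp)).hasFDerivAt
  have := (h1.comp p hγ).clm_apply hu
  simpa [hγp] using this

/-- In a local group with multiplication `μ` and conjugation `κ`, the derivative of the adjoint
action is the antisymmetrization of the mixed second derivative of `μ`. -/
theorem fderiv_conj_eq_of_localGroup {μ κ : E × E → E} {p : E}
    (hμ : ContDiffAt ℝ 2 μ (p, p)) (hκ : ContDiffAt ℝ 2 κ (p, p))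
    (hμ2 : ∀ᶠ a in 𝓝 p, μ (a, p) = a)
    (hκ1 : ∀ᶠ b in 𝓝 p, κ (p, b) = b) (hκ2 : ∀ᶠ a in 𝓝 p, κ (a, p) = p)
    (hμκ : ∀ᶠ q in 𝓝 (p, p), μ (κ q, q.1) = μ q) (v w : E) :
    DifferentiableAt ℝ (fun a => fderiv ℝ (fun b => κ (a, b)) p w) p ∧
    fderiv ℝ (fun a => fderiv ℝ (fun b => κ (a, b)) p w) p v =
      fderiv ℝ (fun a => fderiv ℝ (fun b => μ (a, b)) p w) p v -
        fderiv ℝ (fun a => fderiv ℝ (fun b => μ (a, b)) p v) p w := by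
  have hl : HasFDerivAt (fun a : E => (a, p)) (ContinuousLinearMap.inl ℝ E E) p :=
    (hasFDerivAt_id p).prodMk (hasFDerivAt_const p p)
  have hr : HasFDerivAt (fun a : E => (p, a)) (ContinuousLinearMap.inr ℝ E E) p :=
    (hasFDerivAt_const p p).prodMk (hasFDerivAt_id p)
  set S := fderiv ℝ (fderiv ℝ μ) (p, p) with hS
  have hsymm : ∀ x y, S x y = S y x := fun x y =>
    (hμ.isSymmSndFDerivAt (by simp)).eq x y
  have hderiv : ∀ {f : E × E → E}, ContDiffAt ℝ 2 f (p, p) → ∀ w,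
      HasFDerivAt (fun a => fderiv ℝ (fun b => f (a, b)) p w)
        (((fderiv ℝ (fderiv ℝ f) (p, p)).comp (ContinuousLinearMap.inl ℝ E E)).flip (0, w)) p :=
    fun {f} hf w => by
      have h := hf.hasFDerivAt_fderiv_apply hl rfl (hasFDerivAt_const ((0 : E), w) p)
      rw [ContinuousLinearMap.comp_zero, zero_add] at h
      exact h.congr_of_eventuallyEq (hf.eventually_fderiv_partial_snd.mono fun a ha => ha w)
  refine ⟨(hderiv hκ w).differentiableAt, ?_⟩
  set A : E → E := fun a => fderiv ℝ (fun b => κ (a, b)) p w with hA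
  have hAp : A p = w := by
    have : (fun b => κ (p, b)) =ᶠ[𝓝 p] id := hκ1
    simp [hA, this.fderiv_eq]
  have hμd : DifferentiableAt ℝ μ (p, p) := hμ.differentiableAt (by simp)
  have hμp : ∀ x, fderiv ℝ μ (p, p) (x, 0) = x := fun x => by
    have h1 := HasFDerivAt.comp (f := fun a : E => (a, p)) p hμd.hasFDerivAt hl
    have h2 : (μ ∘ fun a : E => (a, p)) =ᶠ[𝓝 p] id := hμ2
    have h3 := h1.unique ((hasFDerivAt_id p).congr_of_eventuallyEq h2)
    simpa using congrArg (fun T : E →L[ℝ] E => T x) h3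
  -- Differentiate (aba⁻¹)a = ab in b at the identity. A second differentiation, in a, expresses the
  -- derivative of A through the mixed second derivatives of μ.
  have hrel : ∀ᶠ a in 𝓝 p, fderiv ℝ μ (p, a) (A a, 0) = fderiv ℝ μ (a, p) (0, w) := by
    have tl : Filter.Tendsto (fun a => (a, p)) (𝓝 p) (𝓝 (p, p)) := hl.continuousAt
    have tr : Filter.Tendsto (fun a => (p, a)) (𝓝 p) (𝓝 (p, p)) := hr.continuousAt
    have dμ := (hμ.eventually (by simp)).mono fun q hq => hq.differentiableAt (by simp)
    have dκ := (hκ.eventually (by simp)).mono fun q hq => hq.differentiableAt (by simp)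
    filter_upwards [tl.eventually dμ, tr.eventually dμ, tl.eventually dκ, hκ2,
      tl.eventually hμκ.eventually_nhds] with a h1 h2 h3 h4 h5
    have hra : HasFDerivAt (fun b : E => (a, b)) (ContinuousLinearMap.inr ℝ E E) p :=
      (hasFDerivAt_const a p).prodMk (hasFDerivAt_id p)
    have e1 := h1.hasFDerivAt.comp p hra
    have e2 := h3.hasFDerivAt.comp p hra
    have e3 : HasFDerivAt (fun b => (κ (a, b), a)) _ p := e2.prodMk (hasFDerivAt_const a p)
    have e4 : HasFDerivAt μ (fderiv ℝ μ (p, a)) ((fun b => (κ (a, b), a)) p) := by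
      simpa [h4] using h2.hasFDerivAt
    have e5 := e4.comp p e3
    have e6 : (μ ∘ fun b => (κ (a, b), a)) =ᶠ[𝓝 p] (μ ∘ fun b => (a, b)) :=
      hra.continuousAt.eventually h5
    have e7 := (e1.congr_of_eventuallyEq e6).unique e5
    have e8 : A a = fderiv ℝ κ (a, p) (0, w) :=
      congrArg (fun T : E →L[ℝ] E => T w) e2.fderiv
    have e9 := congrArg (fun T : E →L[ℝ] E => T w) e7
    simp only [ContinuousLinearMap.comp_apply, ContinuousLinearMap.inr_apply,
      ContinuousLinearMap.prod_apply, zero_apply] at e9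
    rw [e8]
    exact e9.symm
  have hAd : HasFDerivAt A (fderiv ℝ A p) p := (hderiv hκ w).differentiableAt.hasFDerivAt
  have hu : HasFDerivAt (fun a => (A a, (0 : E))) _ p := hAd.prodMk (hasFDerivAt_const 0 p)
  have d1 := hμ.hasFDerivAt_fderiv_apply hr rfl hu
  have d2 := hμ.hasFDerivAt_fderiv_apply hl rfl (hasFDerivAt_const ((0 : E), w) p)
  have d3 := congrArg (fun T : E →L[ℝ] E => T v) (d1.unique (d2.congr_of_eventuallyEq hrel))
  rw [(hderiv hμ w).fderiv, (hderiv hμ v).fderiv]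
  simp [hμp, hAp] at d3
  simp
  rw [← d3, hsymm (0, v) (w, 0)]
  simp [hS]

end Calculus

theorem VectorField.lieBracketWithin_univ_eq_of_eventuallyEq {E : Type*} [NormedAddCommGroup E]
    [NormedSpace ℝ E] {V W V' W' : E → E} {p v w : E} (hV : V =ᶠ[𝓝 p] V') (hW : W =ᶠ[𝓝 p] W')
    (hv : V' p = v) (hw : W' p = w) :
    lieBracketWithin ℝ V W Set.univ p = fderiv ℝ W' p v - fderiv ℝ V' p w := by
  rw [lieBracketWithin, fderivWithin_univ, fderivWithin_univ, hV.fderiv_eq, hW.fderiv_eq,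
    hV.eq_of_nhds, hW.eq_of_nhds, hv, hw]

namespace LieGroup

section Adjoint

variable {E : Type*} [NormedAddCommGroup E] [NormedSpace ℝ E]
  {G : Type*} [Group G] [TopologicalSpace G] [ChartedSpace E G]

theorem contDiffAt_extChartAt_comp [IsManifold 𝓘(ℝ, E) ∞ G] {P : Type*} [NormedAddCommGroup P]
    [NormedSpace ℝ P]
    {f : P → G} {q : P} (hf : ContMDiffAt 𝓘(ℝ, P) 𝓘(ℝ, E) ∞ f q) (hq : f q = 1) :
    ContDiffAt ℝ ∞ (fun x => extChartAt 𝓘(ℝ, E) (1 : G) (f x)) q := by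
  have h : ContMDiffAt 𝓘(ℝ, E) 𝓘(ℝ, E) ∞ (extChartAt 𝓘(ℝ, E) (1 : G)) (f q) := by
    rw [hq]; exact contMDiffAt_extChartAt
  exact (h.comp q hf).contDiffAt

theorem eventually_symm_extChartAt_one {P : Type*} [TopologicalSpace P] {f : P → G} {q : P}
    (hf : ContinuousAt f q) (hq : f q = 1) :
    ∀ᶠ x in 𝓝 q, (extChartAt 𝓘(ℝ, E) (1 : G)).symm (extChartAt 𝓘(ℝ, E) (1 : G) (f x)) = f x := by
  have : (extChartAt 𝓘(ℝ, E) (1 : G)).source ∈ 𝓝 (f q) := by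
    rw [hq]; exact extChartAt_source_mem_nhds _
  exact (hf.eventually this).mono fun x hx => (extChartAt 𝓘(ℝ, E) (1 : G)).left_inv hx

theorem eventually_extChartAt_symm_one :
    ∀ᶠ x in 𝓝 (extChartAt 𝓘(ℝ, E) (1 : G) 1),
      extChartAt 𝓘(ℝ, E) (1 : G) ((extChartAt 𝓘(ℝ, E) (1 : G)).symm x) = x :=
  Filter.mem_of_superset (extChartAt_target_mem_nhds _)
    fun _ hx => (extChartAt 𝓘(ℝ, E) (1 : G)).right_inv hx

variable (E) in
/-- The adjoint action of a Lie group on its Lie algebra, read in the chart at the identity. -/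
noncomputable def adjoint (g : G) : E →L[ℝ] E :=
  fderiv ℝ (fun b => extChartAt 𝓘(ℝ, E) (1 : G)
    (g * (extChartAt 𝓘(ℝ, E) (1 : G)).symm b * g⁻¹)) (extChartAt 𝓘(ℝ, E) (1 : G) 1)

theorem adjoint_one : adjoint E (1 : G) = ContinuousLinearMap.id ℝ E := by
  refine HasFDerivAt.fderiv ((hasFDerivAt_id _).congr_of_eventuallyEq ?_)
  filter_upwards [eventually_extChartAt_symm_one (E := E) (G := G)] with b hb
  simpa using hb

variable [LieGroup 𝓘(ℝ, E) ∞ G]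

instance instIsManifoldInfty : IsManifold 𝓘(ℝ, E) ∞ G := LieGroup.toContMDiffMul.toIsManifold

instance instMinSmoothness : LieGroup 𝓘(ℝ, E) (minSmoothness ℝ 3) G :=
  LieGroup.of_le (n := ∞) (by
    rw [minSmoothness_of_isRCLikeNormedField]
    exact WithTop.coe_le_coe.2 (le_top : (3 : ℕ∞) ≤ ⊤))

theorem contMDiffAt_symm_one :
    ContMDiffAt 𝓘(ℝ, E) 𝓘(ℝ, E) ∞ (extChartAt 𝓘(ℝ, E) (1 : G)).symm
      (extChartAt 𝓘(ℝ, E) (1 : G) 1) := by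
  exact (contMDiffOn_extChartAt_symm (1 : G)).contMDiffAt (extChartAt_target_mem_nhds _)

theorem contMDiffAt_conj_symm (g : G) :
    ContMDiffAt 𝓘(ℝ, E) 𝓘(ℝ, E) ∞ (fun b => g * (extChartAt 𝓘(ℝ, E) (1 : G)).symm b * g⁻¹)
      (extChartAt 𝓘(ℝ, E) (1 : G) 1) :=
  (contMDiffAt_const.mul contMDiffAt_symm_one).mul contMDiffAt_const

theorem hasFDerivAt_adjoint (g : G) :
    HasFDerivAt (fun b => extChartAt 𝓘(ℝ, E) (1 : G)
      (g * (extChartAt 𝓘(ℝ, E) (1 : G)).symm b * g⁻¹)) (adjoint E g)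
      (extChartAt 𝓘(ℝ, E) (1 : G) 1) :=
  ((contDiffAt_extChartAt_comp (contMDiffAt_conj_symm g) (by simp)).differentiableAt
    (by simp)).hasFDerivAt

theorem adjoint_mul (g h : G) : adjoint E (g * h) = (adjoint E g).comp (adjoint E h) := by
  have h1 : (fun b => extChartAt 𝓘(ℝ, E) (1 : G)
      (h * (extChartAt 𝓘(ℝ, E) (1 : G)).symm b * h⁻¹)) (extChartAt 𝓘(ℝ, E) (1 : G) 1) =
      extChartAt 𝓘(ℝ, E) (1 : G) 1 := by simp
  have h2 := HasFDerivAt.comp (extChartAt 𝓘(ℝ, E) (1 : G) 1)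
    (h1.symm ▸ hasFDerivAt_adjoint (E := E) g) (hasFDerivAt_adjoint h)
  refine HasFDerivAt.fderiv (h2.congr_of_eventuallyEq ?_)
  filter_upwards [eventually_symm_extChartAt_one (E := E) (contMDiffAt_conj_symm h).continuousAt
    (by simp)] with b hb
  simp only [Function.comp, hb]
  congr 1
  group

theorem inverse_mfderivWithin_symm_mulInvariantVectorField (v : GroupLieAlgebra 𝓘(ℝ, E) G) {a : E}
    (ha : a ∈ (extChartAt 𝓘(ℝ, E) (1 : G)).target) :
    (mfderivWithin 𝓘(ℝ, E) 𝓘(ℝ, E) (extChartAt 𝓘(ℝ, E) (1 : G)).symm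
      (Set.range 𝓘(ℝ, E)) a).inverse
      (mulInvariantVectorField v ((extChartAt 𝓘(ℝ, E) (1 : G)).symm a)) =
    fderiv ℝ (fun b => extChartAt 𝓘(ℝ, E) (1 : G) ((extChartAt 𝓘(ℝ, E) (1 : G)).symm a *
      (extChartAt 𝓘(ℝ, E) (1 : G)).symm b)) (extChartAt 𝓘(ℝ, E) (1 : G) 1) v := by
  have : IsManifold 𝓘(ℝ, E) 1 G := IsManifold.of_le (n := ∞) (by simp)
  have h1 := mfderiv_extChartAt_comp_mfderivWithin_extChartAt_symm (I := 𝓘(ℝ, E)) ha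
  have h2 := mfderivWithin_extChartAt_symm_comp_mfderiv_extChartAt (I := 𝓘(ℝ, E)) ha
  rw [ContinuousLinearMap.inverse_eq h2 h1]
  set g := (extChartAt 𝓘(ℝ, E) (1 : G)).symm a with hg
  have hgs : g ∈ (chartAt E (1 : G)).source := by
    have := (extChartAt 𝓘(ℝ, E) (1 : G)).map_target ha
    rwa [extChartAt_source] at this
  have hd : MDifferentiableAt 𝓘(ℝ, E) 𝓘(ℝ, E) (extChartAt 𝓘(ℝ, E) (1 : G)) g :=
    mdifferentiableAt_extChartAt hgs
  have hm : MDifferentiableAt 𝓘(ℝ, E) 𝓘(ℝ, E) (fun h : G => g * h) 1 :=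
    (contMDiff_mul_left (n := ∞)).mdifferentiableAt (by simp)
  have key : ∀ y : G, g * 1 = y →
      MDifferentiableAt 𝓘(ℝ, E) 𝓘(ℝ, E) (extChartAt 𝓘(ℝ, E) (1 : G)) y →
      (mfderiv 𝓘(ℝ, E) 𝓘(ℝ, E) (extChartAt 𝓘(ℝ, E) (1 : G)) y : E →L[ℝ] E)
        ((mfderiv 𝓘(ℝ, E) 𝓘(ℝ, E) (fun h : G => g * h) 1 : E →L[ℝ] E) v) =
      fderiv ℝ (fun b => extChartAt 𝓘(ℝ, E) (1 : G) (g *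
        (extChartAt 𝓘(ℝ, E) (1 : G)).symm b)) (extChartAt 𝓘(ℝ, E) (1 : G) 1) v := by
    rintro _ rfl hd
    have h3 := mfderiv_comp (1 : G) hd hm
    have h4 := (MDifferentiableAt.comp (1 : G) hd hm).mfderiv
    rw [h3] at h4
    have h5 := congrArg (fun T : E →L[ℝ] E => T v) h4
    refine h5.trans ?_
    simp [writtenInExtChartAt, Function.comp_def]
    rfl
  exact key g (mul_one g) hd

/-- In the chart, a left-invariant field at a is the derivative in b of the product ab at the
identity; the formula is the flat Lie bracket of two such fields. -/
theorem bracket_eq_fderiv (v w : GroupLieAlgebra 𝓘(ℝ, E) G) :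
    ⁅v, w⁆ = fderiv ℝ (fun a => fderiv ℝ (fun b => extChartAt 𝓘(ℝ, E) (1 : G)
        ((extChartAt 𝓘(ℝ, E) (1 : G)).symm a * (extChartAt 𝓘(ℝ, E) (1 : G)).symm b))
          (extChartAt 𝓘(ℝ, E) (1 : G) 1) w) (extChartAt 𝓘(ℝ, E) (1 : G) 1) v -
      fderiv ℝ (fun a => fderiv ℝ (fun b => extChartAt 𝓘(ℝ, E) (1 : G)
        ((extChartAt 𝓘(ℝ, E) (1 : G)).symm a * (extChartAt 𝓘(ℝ, E) (1 : G)).symm b))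
          (extChartAt 𝓘(ℝ, E) (1 : G) 1) v) (extChartAt 𝓘(ℝ, E) (1 : G) 1) w := by
  rw [GroupLieAlgebra.bracket_def, mlieBracket, mlieBracketWithin_apply]
  have hid : ((mfderiv 𝓘(ℝ, E) 𝓘(ℝ, E) (extChartAt 𝓘(ℝ, E) (1 : G)) 1).inverse : E →L[ℝ] E) =
      ContinuousLinearMap.id ℝ E := by
    rw [mfderiv_extChartAt_self]
    exact ContinuousLinearMap.inverse_id
  refine (congrArg (fun T : E →L[ℝ] E => T _) hid).trans ?_
  rw [ContinuousLinearMap.id_apply]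
  have hfield : ∀ v : GroupLieAlgebra 𝓘(ℝ, E) G,
      mpullbackWithin 𝓘(ℝ, E) 𝓘(ℝ, E) (extChartAt 𝓘(ℝ, E) (1 : G)).symm
        (mulInvariantVectorField v) (Set.range 𝓘(ℝ, E)) =ᶠ[𝓝 (extChartAt 𝓘(ℝ, E) (1 : G) 1)]
      fun a => fderiv ℝ (fun b => extChartAt 𝓘(ℝ, E) (1 : G)
        ((extChartAt 𝓘(ℝ, E) (1 : G)).symm a * (extChartAt 𝓘(ℝ, E) (1 : G)).symm b))
          (extChartAt 𝓘(ℝ, E) (1 : G) 1) v := fun v =>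
    Filter.mem_of_superset (extChartAt_target_mem_nhds _) fun a ha =>
      inverse_mfderivWithin_symm_mulInvariantVectorField v ha
  have hself : ∀ v : E, fderiv ℝ (fun b => extChartAt 𝓘(ℝ, E) (1 : G)
      ((extChartAt 𝓘(ℝ, E) (1 : G)).symm (extChartAt 𝓘(ℝ, E) (1 : G) 1) *
        (extChartAt 𝓘(ℝ, E) (1 : G)).symm b)) (extChartAt 𝓘(ℝ, E) (1 : G) 1) v = v := fun v => by
    have : (fun b => extChartAt 𝓘(ℝ, E) (1 : G)
      ((extChartAt 𝓘(ℝ, E) (1 : G)).symm (extChartAt 𝓘(ℝ, E) (1 : G) 1) *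
        (extChartAt 𝓘(ℝ, E) (1 : G)).symm b)) =ᶠ[𝓝 (extChartAt 𝓘(ℝ, E) (1 : G) 1)] id := by
      filter_upwards [eventually_extChartAt_symm_one (E := E) (G := G)] with b hb
      simpa using hb
    rw [this.fderiv_eq, fderiv_id]
    rfl
  rw [Set.preimage_univ, Set.univ_inter, modelWithCornersSelf_coe, Set.range_id]
  rw [modelWithCornersSelf_coe, Set.range_id] at hfield
  exact lieBracketWithin_univ_eq_of_eventuallyEq (hfield v) (hfield w) (hself v) (hself w)

/-- The derivative of Ad at the identity is ad. Both are the antisymmetrized mixed second derivative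
of the multiplication. -/
theorem differentiableAt_adjoint_symm_and_fderiv (w : GroupLieAlgebra 𝓘(ℝ, E) G) :
    DifferentiableAt ℝ (fun a => adjoint E ((extChartAt 𝓘(ℝ, E) (1 : G)).symm a) w)
      (extChartAt 𝓘(ℝ, E) (1 : G) 1) ∧
    ∀ v : GroupLieAlgebra 𝓘(ℝ, E) G,
      fderiv ℝ (fun a => adjoint E ((extChartAt 𝓘(ℝ, E) (1 : G)).symm a) w)
      (extChartAt 𝓘(ℝ, E) (1 : G) 1) v = ⁅v, w⁆ := by
  set p := extChartAt 𝓘(ℝ, E) (1 : G) 1 with hp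
  have hψ := contMDiffAt_symm_one (E := E) (G := G)
  have hψp : (extChartAt 𝓘(ℝ, E) (1 : G)).symm p = 1 := by simp [hp]
  have hψc : (chartAt E (1 : G)).symm p = 1 := by simp [hp]
  have h1 : ContMDiffAt 𝓘(ℝ, E × E) 𝓘(ℝ, E) ∞
      (fun q : E × E => (extChartAt 𝓘(ℝ, E) (1 : G)).symm q.1) (p, p) :=
    ContMDiffAt.comp (p, p) hψ contDiffAt_fst.contMDiffAt
  have h2 : ContMDiffAt 𝓘(ℝ, E × E) 𝓘(ℝ, E) ∞
      (fun q : E × E => (extChartAt 𝓘(ℝ, E) (1 : G)).symm q.2) (p, p) :=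
    ContMDiffAt.comp (p, p) hψ contDiffAt_snd.contMDiffAt
  have hm := h1.mul h2
  have hk := hm.mul h1.inv
  have h2le : (2 : ℕ∞ω) ≤ ∞ := WithTop.coe_le_coe.2 (le_top : (2 : ℕ∞) ≤ ⊤)
  have main := fderiv_conj_eq_of_localGroup (p := p)
    ((contDiffAt_extChartAt_comp hm (by simp [hψc])).of_le h2le)
    ((contDiffAt_extChartAt_comp hk (by simp [hψc])).of_le h2le)
    (by filter_upwards [eventually_extChartAt_symm_one (E := E) (G := G)] with b hb
        simpa [hψc] using hb)
    (by filter_upwards [eventually_extChartAt_symm_one (E := E) (G := G)] with b hb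
        simpa [hψc] using hb)
    (by refine Filter.Eventually.of_forall fun a => ?_
        simp [hp])
    (by filter_upwards [eventually_symm_extChartAt_one (E := E) hk.continuousAt (by simp [hψc])]
          with q hq
        simp only [Pi.mul_apply] at hq ⊢
        rw [hq, inv_mul_cancel_right])
  exact ⟨(main 0 w).1, fun v => (main v w).2.trans (bracket_eq_fderiv v w).symm⟩

end Adjoint

end LieGroup

/-! ### Maps with vanishing derivative -/

section ZeroDerivative

variable {𝕜 E E' E'' H H' H'' M M' M'' : Type*} [NontriviallyNormedField 𝕜]
  [NormedAddCommGroup E] [NormedSpace 𝕜 E] [NormedAddCommGroup E'] [NormedSpace 𝕜 E']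
  [NormedAddCommGroup E''] [NormedSpace 𝕜 E''] [TopologicalSpace H] [TopologicalSpace H']
  [TopologicalSpace H''] {I : ModelWithCorners 𝕜 E H} {I' : ModelWithCorners 𝕜 E' H'}
  {I'' : ModelWithCorners 𝕜 E'' H''} [TopologicalSpace M] [ChartedSpace H M]
  [TopologicalSpace M'] [ChartedSpace H' M'] [TopologicalSpace M''] [ChartedSpace H'' M'']

theorem MDifferentiableAt.hasMFDerivAt_zero_comp {g : M' → M''} {f : M → M'} {x : M}
    (hg : MDifferentiableAt I' I'' g (f x)) (hf : HasMFDerivAt I I' f x 0) :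
    HasMFDerivAt I I'' (g ∘ f) x 0 := by
  simpa using hg.hasMFDerivAt.comp x hf

theorem HasMFDerivAt.zero_comp {g : M' → M''} {f : M → M'} {x : M}
    (hg : HasMFDerivAt I' I'' g (f x) 0) (hf : MDifferentiableAt I I' f x) :
    HasMFDerivAt I I'' (g ∘ f) x 0 := by
  simpa using hg.comp x hf.hasMFDerivAt

end ZeroDerivative

theorem isLocallyConstant_of_hasMFDerivAt_zero {E E' H' M N : Type*} [NormedAddCommGroup E]
    [NormedSpace ℝ E] [NormedAddCommGroup E'] [NormedSpace ℝ E'] [TopologicalSpace H']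
    {I' : ModelWithCorners ℝ E' H'} [TopologicalSpace M] [ChartedSpace E M]
    [IsManifold 𝓘(ℝ, E) 1 M] [TopologicalSpace N] [ChartedSpace H' N] [IsManifold I' 1 N]
    {f : M → N} (hf : ∀ x, HasMFDerivAt 𝓘(ℝ, E) I' f x 0) : IsLocallyConstant f := by
  rw [IsLocallyConstant.iff_eventually_eq]
  intro x
  set ψ := extChartAt 𝓘(ℝ, E) x with hψ
  set χ := extChartAt I' (f x) with hχ
  have hcont : ContinuousAt (fun b => f (ψ.symm b)) (ψ x) :=
    ContinuousAt.comp (by rw [extChartAt_to_inv]; exact (hf x).continuousAt)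
      (continuousAt_extChartAt_symm x)
  have hU : ∀ᶠ b in 𝓝 (ψ x), f (ψ.symm b) ∈ χ.source ∧ b ∈ ψ.target := by
    refine Filter.Eventually.and (hcont.eventually ?_) (extChartAt_target_mem_nhds x)
    beta_reduce
    rw [hψ, extChartAt_to_inv]
    exact extChartAt_source_mem_nhds _
  obtain ⟨r, hr, hball⟩ := Metric.eventually_nhds_iff_ball.1 hU
  have hd : ∀ b ∈ Metric.ball (ψ x) r,
      HasFDerivAt (fun b => χ (f (ψ.symm b))) (0 : E →L[ℝ] E') b := by
    intro b hb
    obtain ⟨h1, h2⟩ := hball b hb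
    have d1 : MDifferentiableAt I' 𝓘(ℝ, E') χ (f (ψ.symm b)) :=
      mdifferentiableAt_extChartAt (by rwa [hχ, extChartAt_source] at h1)
    have d2 : MDifferentiableAt 𝓘(ℝ, E) 𝓘(ℝ, E) ψ.symm b :=
      (((contMDiffOn_extChartAt_symm (I := 𝓘(ℝ, E)) (n := 1) x).contMDiffAt
        ((isOpen_extChartAt_target x).mem_nhds h2))).mdifferentiableAt (by simp)
    have := (d1.hasMFDerivAt.comp _ (hf (ψ.symm b))).comp b d2.hasMFDerivAt
    rw [ContinuousLinearMap.comp_zero, ContinuousLinearMap.zero_comp] at this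
    exact this.hasFDerivAt
  have hconst : ∀ b ∈ Metric.ball (ψ x) r, χ (f (ψ.symm b)) = χ (f x) := by
    intro b hb
    have := (convex_ball (ψ x) r).is_const_of_fderivWithin_eq_zero (𝕜 := ℝ)
      (f := fun b => χ (f (ψ.symm b)))
      (fun b hb => (hd b hb).differentiableAt.differentiableWithinAt)
      (fun b hb => by
        rw [fderivWithin_of_isOpen Metric.isOpen_ball hb, (hd b hb).fderiv]) hb
      (Metric.mem_ball_self hr)
    rw [this, hψ, extChartAt_to_inv]
  have hpre : ∀ᶠ y in 𝓝 x, ψ y ∈ Metric.ball (ψ x) r ∧ y ∈ ψ.source :=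
    ((continuousAt_extChartAt x).eventually (Metric.ball_mem_nhds _ hr)).and
      (extChartAt_source_mem_nhds x)
  filter_upwards [hpre] with y hy
  have h1 := hconst _ hy.1
  have h2 := (hball _ hy.1).1
  rw [ψ.left_inv hy.2] at h1 h2
  exact χ.injOn h2 (mem_extChartAt_source (I := I') (f x)) h1

/-! ### Nilpotency passes from the group to its Lie algebra -/

namespace LieGroup

section Nilpotent

variable {E : Type*} [NormedAddCommGroup E] [NormedSpace ℝ E]
  {G : Type*} [Group G] [TopologicalSpace G] [ChartedSpace E G]

variable (E G) in
/-- The upper central series of the adjoint representation. -/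
noncomputable def adjointSeries : ℕ → Submodule ℝ E
  | 0 => ⊥
  | k + 1 => ⨅ g : G, (adjointSeries k).comap
      (adjoint E g - ContinuousLinearMap.id ℝ E : E →L[ℝ] E).toLinearMap

theorem mem_adjointSeries_succ {k : ℕ} {v : E} :
    v ∈ adjointSeries E G (k + 1) ↔ ∀ g : G, adjoint E g v - v ∈ adjointSeries E G k := by
  simp [adjointSeries]

/-- The curve stays in a fixed translate of the k-th subspace, so every linear functional vanishing
on that subspace is constant along it and kills the derivative. -/
theorem fderiv_adjoint_mem_adjointSeries [FiniteDimensional ℝ E] {k : ℕ} {u : E}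
    (hu : u ∈ adjointSeries E G (k + 1)) (x : E)
    (hd : DifferentiableAt ℝ (fun a => adjoint E ((extChartAt 𝓘(ℝ, E) (1 : G)).symm a) u)
      (extChartAt 𝓘(ℝ, E) (1 : G) 1)) :
    fderiv ℝ (fun a => adjoint E ((extChartAt 𝓘(ℝ, E) (1 : G)).symm a) u)
      (extChartAt 𝓘(ℝ, E) (1 : G) 1) x ∈ adjointSeries E G k := by
  by_contra hx
  obtain ⟨l, hl1, hl2⟩ :=
    Submodule.exists_dual_map_eq_bot_of_notMem (R := ℝ) (M := E) hx inferInstance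
  let L : E →L[ℝ] ℝ := LinearMap.toContinuousLinearMap l
  have h3 := L.hasFDerivAt.comp _ hd.hasFDerivAt
  have h4 : (L ∘ fun a => adjoint E ((extChartAt 𝓘(ℝ, E) (1 : G)).symm a) u) =
      fun _ => L u := funext fun a => by
    have : l (adjoint E ((extChartAt 𝓘(ℝ, E) (1 : G)).symm a) u - u) = 0 := by
      rw [← Submodule.mem_bot ℝ, ← hl2]
      exact Submodule.mem_map_of_mem (mem_adjointSeries_succ.1 hu _)
    rw [map_sub, sub_eq_zero] at this
    exact this
  rw [h4] at h3
  exact hl1 (congrArg (fun T : E →L[ℝ] ℝ => T x) (h3.unique (hasFDerivAt_const _ _)))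

variable [LieGroup 𝓘(ℝ, E) ∞ G]

/-- Differentiate [g, f(b)] · f(b) = g f(b) g⁻¹ at the identity, where the derivative of
multiplication is addition. -/
theorem hasFDerivAt_commutator {f : G → G} (hf : ContMDiffAt 𝓘(ℝ, E) 𝓘(ℝ, E) ∞ f 1)
    (hf1 : f 1 = 1) (g : G) :
    HasFDerivAt (fun b => extChartAt 𝓘(ℝ, E) (1 : G)
        ⁅g, f ((extChartAt 𝓘(ℝ, E) (1 : G)).symm b)⁆)
      ((adjoint E g - ContinuousLinearMap.id ℝ E).comp
        (fderiv ℝ (fun b => extChartAt 𝓘(ℝ, E) (1 : G)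
          (f ((extChartAt 𝓘(ℝ, E) (1 : G)).symm b))) (extChartAt 𝓘(ℝ, E) (1 : G) 1)))
      (extChartAt 𝓘(ℝ, E) (1 : G) 1) := by
  set p := extChartAt 𝓘(ℝ, E) (1 : G) 1 with hp
  set φ := extChartAt 𝓘(ℝ, E) (1 : G) with hφ
  have hψ := contMDiffAt_symm_one (E := E) (G := G)
  have hψp : φ.symm p = 1 := extChartAt_to_inv _
  have hfψ : ContMDiffAt 𝓘(ℝ, E) 𝓘(ℝ, E) ∞ (fun b => f (φ.symm b)) p :=
    ContMDiffAt.comp p (by rw [hψp]; exact hf) hψ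
  have hfp : f (φ.symm p) = 1 := by rw [hψp, hf1]
  have hc : ContMDiffAt 𝓘(ℝ, E) 𝓘(ℝ, E) ∞ (fun b => ⁅g, f (φ.symm b)⁆) p := by
    simp only [commutatorElement_def]
    exact ((contMDiffAt_const.mul hfψ).mul contMDiffAt_const).mul hfψ.inv
  have hcp : ⁅g, f (φ.symm p)⁆ = 1 := by rw [hfp, commutatorElement_one_right]
  have dc := ((contDiffAt_extChartAt_comp hc hcp).differentiableAt (by simp)).hasFDerivAt
  have df := ((contDiffAt_extChartAt_comp hfψ hfp).differentiableAt (by simp)).hasFDerivAt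
  have hm : ContMDiffAt 𝓘(ℝ, E × E) 𝓘(ℝ, E) ∞
      (fun q : E × E => φ.symm q.1 * φ.symm q.2) (p, p) :=
    (ContMDiffAt.comp (p, p) hψ contDiffAt_fst.contMDiffAt).mul
      (ContMDiffAt.comp (p, p) hψ contDiffAt_snd.contMDiffAt)
  have dm := ((contDiffAt_extChartAt_comp hm (by simp only [hψp, mul_one])).differentiableAt
    (by simp)).hasFDerivAt
  set M := fderiv ℝ (fun q : E × E => φ (φ.symm q.1 * φ.symm q.2)) (p, p) with hM
  have hM1 : ∀ x, M (x, 0) = x := fun x => by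
    have h1 := HasFDerivAt.comp (f := fun a : E => (a, p)) p dm
      ((hasFDerivAt_id p).prodMk (hasFDerivAt_const p p))
    have h2 := h1.unique ((hasFDerivAt_id p).congr_of_eventuallyEq (by
      filter_upwards [eventually_extChartAt_symm_one (E := E) (G := G)] with b hb
      simp only [Function.comp, hψp, mul_one]; exact hb))
    simpa using congrArg (fun T : E →L[ℝ] E => T x) h2
  have hM2 : ∀ x, M (0, x) = x := fun x => by
    have h1 := HasFDerivAt.comp (f := fun a : E => (p, a)) p dm
      ((hasFDerivAt_const p p).prodMk (hasFDerivAt_id p))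
    have h2 := h1.unique ((hasFDerivAt_id p).congr_of_eventuallyEq (by
      filter_upwards [eventually_extChartAt_symm_one (E := E) (G := G)] with b hb
      simp only [Function.comp, hψp, one_mul]; exact hb))
    simpa using congrArg (fun T : E →L[ℝ] E => T x) h2
  have e1 := HasFDerivAt.comp (f := fun b => (φ ⁅g, f (φ.symm b)⁆, φ (f (φ.symm b)))) p
    (by rw [hcp, hfp]; exact dm) (dc.prodMk df)
  have e2 := HasFDerivAt.comp (f := fun b => φ (f (φ.symm b))) p
    (by rw [hfp]; exact hasFDerivAt_adjoint g) df
  have e3 := e1.unique (e2.congr_of_eventuallyEq (by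
    filter_upwards [eventually_symm_extChartAt_one (E := E) hc.continuousAt hcp,
      eventually_symm_extChartAt_one (E := E) hfψ.continuousAt hfp] with b hb1 hb2
    simp only [Function.comp]
    rw [← hφ] at hb1 hb2 ⊢
    rw [hb1, hb2, commutatorElement_def]
    simp))
  refine dc.congr_fderiv (ContinuousLinearMap.ext fun v => ?_)
  have e4 := congrArg (fun T : E →L[ℝ] E => T v) e3
  simp only [ContinuousLinearMap.comp_apply, ContinuousLinearMap.prod_apply] at e4
  rw [← zero_add (fderiv ℝ (fun b => φ (f (φ.symm b))) p v), ← add_zero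
    (fderiv ℝ (fun b => φ ⁅g, f (φ.symm b)⁆) p v), ← Prod.mk_add_mk, map_add, hM1, zero_add,
    hM2] at e4
  simp only [ContinuousLinearMap.comp_apply, sub_apply, ContinuousLinearMap.id_apply]
  exact eq_sub_of_add_eq e4

/-- Working with smooth maps into the k-th central subgroup avoids giving that subgroup a Lie
structure. Induction replaces f by h ↦ [g, f(h)], which lands one step lower and has derivative (Ad
g - 1) ∘ df. For f = id and k the nilpotency class, this fills the whole Lie algebra. -/
theorem fderiv_mem_adjointSeries (k : ℕ) {f : G → G}
    (hf : ContMDiffAt 𝓘(ℝ, E) 𝓘(ℝ, E) ∞ f 1) (hf1 : f 1 = 1)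
    (hk : ∀ h, f h ∈ Subgroup.upperCentralSeries G k) (v : E) :
    fderiv ℝ (fun b => extChartAt 𝓘(ℝ, E) (1 : G)
      (f ((extChartAt 𝓘(ℝ, E) (1 : G)).symm b))) (extChartAt 𝓘(ℝ, E) (1 : G) 1) v ∈
      adjointSeries E G k := by
  induction k generalizing f with
  | zero =>
    have : f = fun _ => 1 := funext fun h => by
      simpa [Subgroup.upperCentralSeries_zero] using hk h
    subst this
    simp [adjointSeries]
  | succ k ih =>
    rw [mem_adjointSeries_succ]
    intro g
    have hc : ContMDiffAt 𝓘(ℝ, E) 𝓘(ℝ, E) ∞ (fun h => ⁅g, f h⁆) 1 := by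
      simp only [commutatorElement_def]
      exact ((contMDiffAt_const.mul hf).mul contMDiffAt_const).mul hf.inv
    have := ih hc (by rw [hf1, commutatorElement_one_right]) fun h => by
      rw [← inv_mem_iff, commutatorElement_inv]
      exact Subgroup.mem_upperCentralSeries_succ_iff.1 (hk h) g
    rw [(hasFDerivAt_commutator hf hf1 g).fderiv] at this
    exact this

theorem adjointSeries_eq_top [Group.IsNilpotent G] : ∃ n, adjointSeries E G n = ⊤ := by
  obtain ⟨n, hn⟩ := Group.IsNilpotent.nilpotent G
  refine ⟨n, eq_top_iff.2 fun v _ => ?_⟩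
  have := fderiv_mem_adjointSeries (E := E) n (f := (id : G → G)) contMDiffAt_id rfl
    (fun h => by rw [hn]; trivial) v
  have h : (fun b => extChartAt 𝓘(ℝ, E) (1 : G) (id ((extChartAt 𝓘(ℝ, E) (1 : G)).symm b)))
      =ᶠ[𝓝 (extChartAt 𝓘(ℝ, E) (1 : G) 1)] id := eventually_extChartAt_symm_one
  rwa [h.fderiv_eq, fderiv_id] at this

theorem bracket_mem_adjointSeries [FiniteDimensional ℝ E] {k : ℕ}
    {u : GroupLieAlgebra 𝓘(ℝ, E) G} (hu : (u : E) ∈ adjointSeries E G (k + 1))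
    (x : GroupLieAlgebra 𝓘(ℝ, E) G) :
    (⁅x, u⁆ : GroupLieAlgebra 𝓘(ℝ, E) G) ∈ adjointSeries E G k := by
  obtain ⟨h1, h2⟩ := differentiableAt_adjoint_symm_and_fderiv u
  have := fderiv_adjoint_mem_adjointSeries (E := E) (G := G) (u := u) hu x h1
  exact (h2 x) ▸ this

theorem isNilpotent_groupLieAlgebra [FiniteDimensional ℝ E] [CompleteSpace E]
    [Group.IsNilpotent G] : LieRing.IsNilpotent (GroupLieAlgebra 𝓘(ℝ, E) G) := by
  refine (LieModule.isNilpotent_iff_exists_ucs_eq_top ℝ).2 ?_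
  obtain ⟨n, hn⟩ := adjointSeries_eq_top (E := E) (G := G)
  have key : ∀ k, ∀ u : GroupLieAlgebra 𝓘(ℝ, E) G, (u : E) ∈ adjointSeries E G k →
      u ∈ (⊥ : LieSubmodule ℝ (GroupLieAlgebra 𝓘(ℝ, E) G) (GroupLieAlgebra 𝓘(ℝ, E) G)).ucs k := by
    intro k
    induction k with
    | zero =>
      intro u hu
      rw [LieSubmodule.ucs_zero, LieSubmodule.mem_bot]
      exact hu
    | succ k ih =>
      intro u hu
      rw [LieSubmodule.ucs_succ, LieSubmodule.mem_normalizer]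
      exact fun x => ih _ (bracket_mem_adjointSeries hu x)
  exact ⟨n, eq_top_iff.2 fun u _ => key n u (by rw [hn]; trivial)⟩

end Nilpotent

/-! ### Connected groups with abelian Lie algebra -/

section Commutative

variable {E : Type*} [NormedAddCommGroup E] [NormedSpace ℝ E]
  {G : Type*} [Group G] [TopologicalSpace G] [ChartedSpace E G] [LieGroup 𝓘(ℝ, E) ∞ G]

/-- The derivative of Ad vanishes at the identity, hence everywhere by Ad(b) = Ad(a) Ad(a⁻¹b), so Ad
is constant. -/
theorem adjoint_eq_id_of_bracket_eq_zero [PreconnectedSpace G]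
    (h : ∀ v w : GroupLieAlgebra 𝓘(ℝ, E) G, ⁅v, w⁆ = 0) (g : G) :
    adjoint E g = ContinuousLinearMap.id ℝ E := by
  refine ContinuousLinearMap.ext fun w => ?_
  obtain ⟨h1, h2⟩ := differentiableAt_adjoint_symm_and_fderiv (G := G) w
  have h3 : ∀ y : G, y = 1 → HasMFDerivAt 𝓘(ℝ, E) 𝓘(ℝ, E) (fun g : G => adjoint E g w) y 0 := by
    rintro _ rfl
    have h0 : HasFDerivAt (fun a => adjoint E ((extChartAt 𝓘(ℝ, E) (1 : G)).symm a) w)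
        (0 : E →L[ℝ] E) (extChartAt 𝓘(ℝ, E) (1 : G) 1) :=
      h1.hasFDerivAt.congr_fderiv (ContinuousLinearMap.ext fun v => (h2 v).trans (h v w))
    refine ⟨?_, ?_⟩
    · have : ContinuousAt (fun g : G => adjoint E ((extChartAt 𝓘(ℝ, E) (1 : G)).symm
          (extChartAt 𝓘(ℝ, E) (1 : G) g)) w) 1 :=
        ContinuousAt.comp h0.continuousAt (continuousAt_extChartAt 1)
      refine this.congr ?_
      filter_upwards [eventually_symm_extChartAt_one (E := E) (continuousAt_id (x := (1 : G))) rfl]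
        with g hg
      exact congrArg (fun g => adjoint E g w) hg
    · exact h0.hasFDerivWithinAt
  have h4 : ∀ a : G, HasMFDerivAt 𝓘(ℝ, E) 𝓘(ℝ, E) (fun g : G => adjoint E g w) a 0 := by
    intro a
    have e1 : MDifferentiableAt 𝓘(ℝ, E) 𝓘(ℝ, E) (fun h : G => a⁻¹ * h) a :=
      (contMDiff_mul_left (n := ∞)).mdifferentiableAt (by simp)
    have e2 := (adjoint E a).mdifferentiableAt.hasMFDerivAt_zero_comp
      ((h3 (a⁻¹ * a) (inv_mul_cancel a)).zero_comp e1)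
    refine e2.congr_of_eventuallyEq (Filter.Eventually.of_forall fun b => ?_)
    simp only [Function.comp]
    rw [← ContinuousLinearMap.comp_apply, ← adjoint_mul, mul_inv_cancel_left]
  have := IsManifold.of_le (I := 𝓘(ℝ, E)) (M := G) (m := 1) (n := ∞) (by simp)
  have h5 := (isLocallyConstant_of_hasMFDerivAt_zero h4).apply_eq_of_preconnectedSpace g 1
  rw [h5, adjoint_one]

theorem commute_of_bracket_eq_zero [PreconnectedSpace G]
    (h : ∀ v w : GroupLieAlgebra 𝓘(ℝ, E) G, ⁅v, w⁆ = 0) (g x : G) : g * x = x * g := by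
  have hsmooth : ContMDiff 𝓘(ℝ, E) 𝓘(ℝ, E) ∞ fun x : G => ⁅g, x⁆ := by
    simp only [commutatorElement_def]
    exact ((contMDiff_const.mul contMDiff_id).mul contMDiff_const).mul contMDiff_id.inv
  have h1 : ∀ y : G, y = 1 → HasMFDerivAt 𝓘(ℝ, E) 𝓘(ℝ, E) (fun x : G => ⁅g, x⁆) y 0 := by
    rintro _ rfl
    refine ⟨hsmooth.continuous.continuousAt, ?_⟩
    have := hasFDerivAt_commutator (E := E) (f := (id : G → G)) contMDiffAt_id rfl g
    rw [adjoint_eq_id_of_bracket_eq_zero h, sub_self, ContinuousLinearMap.zero_comp] at this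
    rw [writtenInExtChartAt, commutatorElement_one_right]
    exact this.hasFDerivWithinAt
  have h2 : ∀ a : G, HasMFDerivAt 𝓘(ℝ, E) 𝓘(ℝ, E) (fun x : G => ⁅g, x⁆) a 0 := by
    intro a
    have e1 : MDifferentiableAt 𝓘(ℝ, E) 𝓘(ℝ, E) (fun h : G => a⁻¹ * h) a :=
      (contMDiff_mul_left (n := ∞)).mdifferentiableAt (by simp)
    have e3 : MDifferentiableAt 𝓘(ℝ, E) 𝓘(ℝ, E) (fun k : G => (g * a * g⁻¹) * k * a⁻¹)
        ⁅g, a⁻¹ * a⁆ :=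
      ((contMDiff_const.mul contMDiff_id).mul contMDiff_const).mdifferentiableAt
        (n := ∞) (by simp)
    have e4 := e3.hasMFDerivAt_zero_comp (f := (fun x : G => ⁅g, x⁆) ∘ fun h => a⁻¹ * h)
      ((h1 (a⁻¹ * a) (inv_mul_cancel a)).zero_comp e1)
    -- The identity [g, x] = (gag⁻¹)[g, a⁻¹x]a⁻¹ transports the vanishing derivative from 1, where
    -- it equals Ad g - 1, to a.
    have e5 : ((fun k : G => (g * a * g⁻¹) * k * a⁻¹) ∘
        ((fun x : G => ⁅g, x⁆) ∘ fun h => a⁻¹ * h)) = fun x => ⁅g, x⁆ := funext fun b => by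
      simp only [Function.comp, commutatorElement_def]
      group
    rw [e5] at e4
    exact e4
  have := IsManifold.of_le (I := 𝓘(ℝ, E)) (M := G) (m := 1) (n := ∞) (by simp)
  have h5 := (isLocallyConstant_of_hasMFDerivAt_zero h2).apply_eq_of_preconnectedSpace x 1
  rw [commutatorElement_one_right, commutatorElement_eq_one_iff_mul_comm] at h5
  exact h5

end Commutative

end LieGroup

/-! ### One-parameter subgroups -/

theorem IsMIntegralCurveAt.contMDiffAt {E : Type*} [NormedAddCommGroup E] [NormedSpace ℝ E]
    [CompleteSpace E] {M : Type*} [TopologicalSpace M] [ChartedSpace E M]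
    [IsManifold 𝓘(ℝ, E) ∞ M] {γ : ℝ → M} {v : (x : M) → TangentSpace 𝓘(ℝ, E) x} {t₀ : ℝ}
    (hγ : IsMIntegralCurveAt γ v t₀)
    (hv : ContMDiffAt 𝓘(ℝ, E) (𝓘(ℝ, E).tangent) ∞ (fun x => (⟨x, v x⟩ : TangentBundle 𝓘(ℝ, E) M))
      (γ t₀)) :
    ContMDiffAt 𝓘(ℝ, ℝ) 𝓘(ℝ, E) ∞ γ t₀ := by
  have := IsManifold.of_le (I := 𝓘(ℝ, E)) (M := M) (m := 1) (n := ∞) (by simp)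
  set φ := extChartAt 𝓘(ℝ, E) (γ t₀) with hφ
  set w : E → E := fun a => tangentCoordChange 𝓘(ℝ, E) (φ.symm a) (γ t₀) (φ.symm a)
    (v (φ.symm a)) with hw
  have hw_smooth : ContDiffAt ℝ ∞ w (φ (γ t₀)) := by
    rw [contMDiffAt_iff] at hv
    obtain ⟨_, hv⟩ := hv
    exact (hv.contDiffAt (by simp)).snd
  have hcont := hγ.continuousAt
  have h1 : ∀ᶠ t in 𝓝 t₀, HasDerivAt (φ ∘ γ) (w ((φ ∘ γ) t)) t := by
    filter_upwards [hγ.eventually_hasDerivAt,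
      hcont.eventually (extChartAt_source_mem_nhds (I := 𝓘(ℝ, E)) (γ t₀))] with t ht hs
    have : φ.symm ((φ ∘ γ) t) = γ t := φ.left_inv hs
    simp only [hw]
    rw [this]
    exact ht
  have hφγ : ContinuousAt (φ ∘ γ) t₀ := (continuousAt_extChartAt _).comp hcont
  have h2 : ContDiffAt ℝ ∞ (φ ∘ γ) t₀ := by
    rw [contDiffAt_infty]
    intro n
    obtain ⟨u, hu, hwu⟩ := (contDiffAt_infty.1 hw_smooth n).contDiffOn le_rfl (by simp)
    obtain ⟨ε, hε, hball⟩ := Metric.eventually_nhds_iff_ball.1 (h1.and (hφγ.eventually hu))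
    have hI : Set.Icc (t₀ - ε / 2) (t₀ + ε / 2) ⊆ Metric.ball t₀ ε := by
      rw [← Real.closedBall_eq_Icc]
      exact Metric.closedBall_subset_ball (by linarith)
    have h3 := ODE.contDiffOn_enat_Icc_of_hasDerivWithinAt (n := n) (f := fun _ => w) (u := u)
      (α := φ ∘ γ) (tmin := t₀ - ε / 2) (tmax := t₀ + ε / 2)
      (hwu.comp contDiff_snd.contDiffOn fun p hp => hp.2)
      (fun t ht => (hball t (hI ht)).1.hasDerivWithinAt) fun t ht => (hball t (hI ht)).2
    exact h3.contDiffAt (Icc_mem_nhds (by linarith) (by linarith))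
  have h3 : ContMDiffAt 𝓘(ℝ, ℝ) 𝓘(ℝ, E) ∞ (φ.symm ∘ (φ ∘ γ)) t₀ := by
    refine ContMDiffAt.comp t₀ ?_ h2.contMDiffAt
    exact (contMDiffOn_extChartAt_symm (γ t₀)).contMDiffAt (extChartAt_target_mem_nhds (γ t₀))
  refine h3.congr_of_eventuallyEq ?_
  filter_upwards [hcont.eventually (extChartAt_source_mem_nhds (I := 𝓘(ℝ, E)) (γ t₀))] with t ht
  exact (φ.left_inv ht).symm

namespace LieGroup

section OneParameter

variable {E : Type*} [NormedAddCommGroup E] [NormedSpace ℝ E]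
  {G : Type*} [Group G] [TopologicalSpace G] [ChartedSpace E G]

theorem mulInvariantVectorField_eq_self (v : GroupLieAlgebra 𝓘(ℝ, E) G) {k : G} (hk : k = 1) :
    (mulInvariantVectorField v k : E) = v := by
  subst hk
  have h : (fun x : G => 1 * x) = id := funext one_mul
  rw [mulInvariantVectorField, h]
  exact congrArg (fun T : E →L[ℝ] E => T v) mfderiv_id

variable [LieGroup 𝓘(ℝ, E) ∞ G]

theorem contMDiff_mulInvariantVectorField_infty (v : GroupLieAlgebra 𝓘(ℝ, E) G) :
    ContMDiff 𝓘(ℝ, E) (𝓘(ℝ, E).tangent) ∞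
      (fun g : G => (⟨g, mulInvariantVectorField v g⟩ : TangentBundle 𝓘(ℝ, E) G)) := by
  -- The field is the image of the pair (zero vector at g, v at 1) under the tangent map of
  -- multiplication.
  let fg : G → TangentBundle 𝓘(ℝ, E) G := fun g ↦ TotalSpace.mk' E g 0
  have sfg : ContMDiff 𝓘(ℝ, E) (𝓘(ℝ, E).tangent) ∞ fg := contMDiff_zeroSection _ _
  let fv : G → TangentBundle 𝓘(ℝ, E) G := fun _ ↦ TotalSpace.mk' E 1 v
  have sfv : ContMDiff 𝓘(ℝ, E) (𝓘(ℝ, E).tangent) ∞ fv := contMDiff_const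
  have S₁ := sfg.prodMk sfv
  have S₂ := contMDiff_equivTangentBundleProd_symm (n := ∞) (I := 𝓘(ℝ, E)) (M := G)
    (I' := 𝓘(ℝ, E)) (M' := G)
  have S₃ := ContMDiff.contMDiff_tangentMap (contMDiff_mul 𝓘(ℝ, E) ∞ (G := G)) (m := ∞) (by simp)
  convert! (S₃.comp S₂).comp S₁ with g
  · simp [fg, fv]
  · simp only [Function.comp_apply, tangentMap, fg, fv]
    rw [mfderiv_prod_eq_add_apply ((contMDiff_mul 𝓘(ℝ, E) ∞).mdifferentiableAt (by simp))]
    refine (Eq.trans (congrArg₂ (fun a b : E => a + b)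
      ((mfderiv 𝓘(ℝ, E) 𝓘(ℝ, E) (fun z : G => z * 1) g : E →L[ℝ] E).map_zero) ?_) (zero_add _)).symm
    simp only [mulInvariantVectorField]
    rfl

theorem mfderiv_mul_left_mulInvariantVectorField (v : GroupLieAlgebra 𝓘(ℝ, E) G) (a g : G) :
    mfderiv 𝓘(ℝ, E) 𝓘(ℝ, E) (fun x => a * x) g (mulInvariantVectorField v g) =
      mulInvariantVectorField v (a * g) := by
  have h1 : MDifferentiableAt 𝓘(ℝ, E) 𝓘(ℝ, E) (fun x : G => a * x) (g * 1) :=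
    (contMDiff_mul_left (n := ∞)).mdifferentiableAt (by simp)
  have h2 : MDifferentiableAt 𝓘(ℝ, E) 𝓘(ℝ, E) (fun x : G => g * x) 1 :=
    (contMDiff_mul_left (n := ∞)).mdifferentiableAt (by simp)
  have h3 := mfderiv_comp (1 : G) h1 h2
  have h4 : ((fun x : G => a * x) ∘ fun x => g * x) = fun x => a * g * x :=
    funext fun x => (mul_assoc _ _ _).symm
  rw [h4] at h3
  have h5 := congrArg (fun T : E →L[ℝ] E => T v) h3
  have h6 : ∀ y, y = g → (mfderiv 𝓘(ℝ, E) 𝓘(ℝ, E) (fun x : G => a * x) y : E →L[ℝ] E) =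
      (mfderiv 𝓘(ℝ, E) 𝓘(ℝ, E) (fun x : G => a * x) g : E →L[ℝ] E) := by rintro _ rfl; rfl
  refine Eq.trans ?_ h5.symm
  exact congrArg (fun T : E →L[ℝ] E => T (mulInvariantVectorField v g)) (h6 _ (mul_one g)).symm

theorem isMIntegralCurveOn_mul_left {γ : ℝ → G} {v : GroupLieAlgebra 𝓘(ℝ, E) G} {s : Set ℝ}
    (hγ : IsMIntegralCurveOn γ (mulInvariantVectorField v) s) (a : G) :
    IsMIntegralCurveOn (fun t => a * γ t) (mulInvariantVectorField v) s := by
  intro t ht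
  have h1 : MDifferentiableAt 𝓘(ℝ, E) 𝓘(ℝ, E) (fun x : G => a * x) (γ t) :=
    (contMDiff_mul_left (n := ∞)).mdifferentiableAt (by simp)
  refine (h1.hasMFDerivAt.comp_hasMFDerivWithinAt t (hγ t ht)).congr_mfderiv ?_
  refine ContinuousLinearMap.ext fun c => ?_
  have := mfderiv_mul_left_mulInvariantVectorField v a (γ t)
  refine Eq.trans ?_ (congrArg (fun z : E => (show ℝ from c) • z) this)
  exact (mfderiv 𝓘(ℝ, E) 𝓘(ℝ, E) (fun x : G => a * x) (γ t) : E →L[ℝ] E).map_smul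
    (show ℝ from c) (mulInvariantVectorField v (γ t) : E)

/-- Left translates of one local integral curve give the same existence time at every point, so
integral curves are global. Uniqueness applied to γ(s + t) and γ(s)γ(t) gives the homomorphism law.
-/
theorem exists_oneParameterSubgroup [CompleteSpace E] [T2Space G]
    (v : GroupLieAlgebra 𝓘(ℝ, E) G) :
    ∃ γ : ℝ → G, γ 0 = 1 ∧ (∀ s t, γ (s + t) = γ s * γ t) ∧
      (∀ g : G, IsMIntegralCurve (fun t => g * γ t) (mulInvariantVectorField v)) ∧
      ContMDiff 𝓘(ℝ, ℝ) 𝓘(ℝ, E) ∞ γ := by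
  have := IsManifold.of_le (I := 𝓘(ℝ, E)) (M := G) (m := 1) (n := ∞) (by simp)
  have hv := contMDiff_mulInvariantVectorField_infty v
  have hv1 := hv.of_le (m := 1) (by simp)
  obtain ⟨γ₀, h0, h1⟩ := exists_isMIntegralCurveAt_of_contMDiffAt_boundaryless 0
    (hv1.contMDiffAt (x := 1))
  obtain ⟨ε, hε, h2⟩ := isMIntegralCurveAt_iff'.1 h1
  rw [Real.ball_eq_Ioo, zero_sub, zero_add] at h2
  obtain ⟨γ, hγ0, hγ⟩ := exists_isMIntegralCurve_of_isMIntegralCurveOn hv1 hε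
    (fun x => ⟨fun t => x * γ₀ t, by simp [h0], isMIntegralCurveOn_mul_left h2 x⟩) 1
  have hmul : ∀ g : G, IsMIntegralCurve (fun t => g * γ t) (mulInvariantVectorField v) :=
    fun g => isMIntegralCurve_iff_isMIntegralCurveOn.2
      (isMIntegralCurveOn_mul_left (isMIntegralCurve_iff_isMIntegralCurveOn.1 hγ) g)
  refine ⟨γ, hγ0, fun s t => ?_, hmul, fun t =>
    (hγ.isMIntegralCurveAt t).contMDiffAt hv.contMDiffAt⟩
  have := isMIntegralCurve_Ioo_eq_of_contMDiff_boundaryless (t₀ := 0) hv1 (hγ.comp_add s)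
    (hmul (γ s)) (by simp [hγ0])
  have := congrFun this t
  simpa [add_comm] using this

end OneParameter

end LieGroup

/-! ### Related vector fields and the invariant frame on the quotient -/

section LocalDiffeomorph

variable {E : Type*} [NormedAddCommGroup E] [NormedSpace ℝ E]
  {M : Type*} [TopologicalSpace M] [ChartedSpace E M] [IsManifold 𝓘(ℝ, E) ∞ M]
  {X : Type*} [TopologicalSpace X] [ChartedSpace E X] [IsManifold 𝓘(ℝ, E) ∞ X]
  {p : M → X} {V : (a : M) → TangentSpace 𝓘(ℝ, E) a} {W : (x : X) → TangentSpace 𝓘(ℝ, E) x}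

theorem IsLocalDiffeomorphAt.contMDiffAt_of_related {a : M}
    (hp : IsLocalDiffeomorphAt 𝓘(ℝ, E) 𝓘(ℝ, E) ∞ p a) (hp' : ContMDiff 𝓘(ℝ, E) 𝓘(ℝ, E) ∞ p)
    (hV : ContMDiff 𝓘(ℝ, E) 𝓘(ℝ, E).tangent ∞ fun a => (⟨a, V a⟩ : TangentBundle 𝓘(ℝ, E) M))
    (h : ∀ a, W (p a) = mfderiv 𝓘(ℝ, E) 𝓘(ℝ, E) p a (V a)) :
    ContMDiffAt 𝓘(ℝ, E) 𝓘(ℝ, E).tangent ∞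
      (fun x => (⟨x, W x⟩ : TangentBundle 𝓘(ℝ, E) X)) (p a) := by
  have h1 := hp.localInverse_contMDiffAt
  have h2 := ((hp'.contMDiff_tangentMap (m := ∞) (by simp)).comp hV).contMDiffAt.comp (p a) h1
  refine h2.congr_of_eventuallyEq ?_
  filter_upwards [hp.localInverse_eventuallyEq_right] with y hy
  have h3 : p (hp.localInverse y) = y := hy
  have h4 : ∀ z : X, z = y → (⟨y, W y⟩ : TangentBundle 𝓘(ℝ, E) X) = ⟨z, W z⟩ := by
    rintro _ rfl; rfl
  rw [h4 _ h3, h]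
  rfl

theorem IsLocalDiffeomorph.mlieBracket_of_related [CompleteSpace E]
    {V' : (a : M) → TangentSpace 𝓘(ℝ, E) a} {W' : (x : X) → TangentSpace 𝓘(ℝ, E) x}
    (hp : IsLocalDiffeomorph 𝓘(ℝ, E) 𝓘(ℝ, E) ∞ p) (a : M)
    (hW : MDifferentiableAt 𝓘(ℝ, E) 𝓘(ℝ, E).tangent
      (fun x => (⟨x, W x⟩ : TangentBundle 𝓘(ℝ, E) X)) (p a))
    (hW' : MDifferentiableAt 𝓘(ℝ, E) 𝓘(ℝ, E).tangent
      (fun x => (⟨x, W' x⟩ : TangentBundle 𝓘(ℝ, E) X)) (p a))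
    (h : ∀ a, W (p a) = mfderiv 𝓘(ℝ, E) 𝓘(ℝ, E) p a (V a))
    (h' : ∀ a, W' (p a) = mfderiv 𝓘(ℝ, E) 𝓘(ℝ, E) p a (V' a)) :
    mlieBracket 𝓘(ℝ, E) W W' (p a) =
      mfderiv 𝓘(ℝ, E) 𝓘(ℝ, E) p a (mlieBracket 𝓘(ℝ, E) V V' a) := by
  have : IsManifold 𝓘(ℝ, E) (minSmoothness ℝ 2) M :=
    IsManifold.of_le (n := ∞) (by simp; exact WithTop.coe_le_coe.2 (le_top : (2 : ℕ∞) ≤ ⊤))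
  have : IsManifold 𝓘(ℝ, E) (minSmoothness ℝ 2) X :=
    IsManifold.of_le (n := ∞) (by simp; exact WithTop.coe_le_coe.2 (le_top : (2 : ℕ∞) ≤ ⊤))
  have hinv : ∀ b, (mfderiv 𝓘(ℝ, E) 𝓘(ℝ, E) p b).IsInvertible := fun b =>
    ⟨hp.mfderivToContinuousLinearEquiv (by simp) b, rfl⟩
  have key : ∀ (V : (a : M) → TangentSpace 𝓘(ℝ, E) a) (W : (x : X) → TangentSpace 𝓘(ℝ, E) x),
      (∀ a, W (p a) = mfderiv 𝓘(ℝ, E) 𝓘(ℝ, E) p a (V a)) →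
      mpullback 𝓘(ℝ, E) 𝓘(ℝ, E) p W = V := fun V W h => funext fun b => by
    rw [mpullback_apply, h, (hinv b).inverse_apply_self]
  have h1 := mpullback_mlieBracket (n := ∞) hW hW' (hp a).contMDiffAt
    (by simp; exact WithTop.coe_le_coe.2 (le_top : (2 : ℕ∞) ≤ ⊤))
  rw [key V W h, key V' W' h'] at h1
  rw [← h1, mpullback_apply, (hinv a).self_apply_inverse]

end LocalDiffeomorph

namespace Nilmfd

namespace QuotientPresentation

variable {G : Type*} [Group G] [TopologicalSpace G] [ChartedSpace (EuclideanSpace ℝ (Fin 6)) G]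
  {X : Type*} [TopologicalSpace X] [ChartedSpace (EuclideanSpace ℝ (Fin 6)) X]
  (N : QuotientPresentation G X)

theorem proj_mul {γ : G} (hγ : γ ∈ N.lattice) (g : G) : N.proj (γ * g) = N.proj g :=
  ((N.proj_eq_iff _ _).2 ⟨γ, hγ, rfl⟩).symm

theorem frame_add (v w : GroupLieAlgebra (𝓡 6) G) (g : G) :
    N.frame (v + w) g = N.frame v g + N.frame w g := by
  rw [frame, mulInvariantVectorField_add, Pi.add_apply, map_add]; rfl

theorem frame_smul (c : ℝ) (v : GroupLieAlgebra (𝓡 6) G) (g : G) :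
    N.frame (c • v) g = c • N.frame v g := by
  rw [frame, mulInvariantVectorField_smul, Pi.smul_apply, map_smul]; rfl

variable [LieGroup (𝓡 6) ∞ G]

/-- This is why a left-invariant field descends to Γ\G. Stating the equality in the model space
avoids a transport between the tangent spaces at two propositionally equal points. -/
theorem frame_mul (v : GroupLieAlgebra (𝓡 6) G) {γ : G} (hγ : γ ∈ N.lattice) (g : G) :
    (N.frame v (γ * g) : EuclideanSpace ℝ (Fin 6)) = N.frame v g := by
  have h1 : MDifferentiableAt (𝓡 6) (𝓡 6) N.proj (γ * g) :=
    N.isLocalDiffeomorph.mdifferentiable (by simp) _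
  have h2 : MDifferentiableAt (𝓡 6) (𝓡 6) (fun x : G => γ * x) g :=
    (contMDiff_mul_left (n := ∞)).mdifferentiableAt (by simp)
  have h3 := mfderiv_comp g h1 h2
  rw [show N.proj ∘ (fun x : G => γ * x) = N.proj from funext fun x => N.proj_mul hγ x] at h3
  have h4 := LieGroup.mfderiv_mul_left_mulInvariantVectorField v γ g
  have h5 := congrArg (fun T : EuclideanSpace ℝ (Fin 6) →L[ℝ] EuclideanSpace ℝ (Fin 6) =>
    T (mulInvariantVectorField v g)) h3
  refine (h5.trans ?_).symm
  exact congrArg (mfderiv (𝓡 6) (𝓡 6) N.proj (γ * g)) h4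

theorem frame_eq_of_proj_eq (v : GroupLieAlgebra (𝓡 6) G) {g h : G} (hgh : N.proj g = N.proj h) :
    (N.frame v g : EuclideanSpace ℝ (Fin 6)) = N.frame v h := by
  obtain ⟨γ, hγ, rfl⟩ := (N.proj_eq_iff _ _).1 hgh
  exact (N.frame_mul v hγ g).symm

theorem frame_injective (g : G) : Function.Injective fun v => N.frame v g := by
  intro v w h
  have h1 := (N.isLocalDiffeomorph.mfderivToContinuousLinearEquiv (by simp) g).injective h
  have h2 : ∀ v : GroupLieAlgebra (𝓡 6) G, (mfderiv (𝓡 6) (𝓡 6) (fun x : G => g⁻¹ * x) g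
      (mulInvariantVectorField v g) : EuclideanSpace ℝ (Fin 6)) = v := fun v =>
    (LieGroup.mfderiv_mul_left_mulInvariantVectorField v g⁻¹ g).trans
      (LieGroup.mulInvariantVectorField_eq_self v (inv_mul_cancel g))
  exact (h2 v).symm.trans ((congrArg (mfderiv (𝓡 6) (𝓡 6) (fun x : G => g⁻¹ * x) g) h1).trans
    (h2 w))

/-- The vector field on the quotient induced by a left-invariant vector field. -/
noncomputable def vectorField (v : GroupLieAlgebra (𝓡 6) G) (x : X) : TangentSpace (𝓡 6) x :=
  (N.frame v (Function.surjInv N.surjective x) : EuclideanSpace ℝ (Fin 6))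

theorem vectorField_proj (v : GroupLieAlgebra (𝓡 6) G) (g : G) :
    N.vectorField v (N.proj g) = N.frame v g :=
  N.frame_eq_of_proj_eq v (Function.surjInv_eq N.surjective _)

variable [IsManifold (𝓡 6) ∞ X]

theorem contMDiff_vectorField (v : GroupLieAlgebra (𝓡 6) G) :
    ContMDiff (𝓡 6) (𝓡 6).tangent ∞
      fun x => (⟨x, N.vectorField v x⟩ : TangentBundle (𝓡 6) X) := fun x => by
  obtain ⟨g, rfl⟩ := N.surjective x
  exact (N.isLocalDiffeomorph g).contMDiffAt_of_related N.isLocalDiffeomorph.contMDiff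
    (LieGroup.contMDiff_mulInvariantVectorField_infty v) (N.vectorField_proj v)

/-- The smooth vector field on the quotient induced by a left-invariant vector field. -/
noncomputable def smoothVectorField (v : GroupLieAlgebra (𝓡 6) G) : SmoothVectorField X where
  val := N.vectorField v
  contMDiff := N.contMDiff_vectorField v

theorem mlieBracket_vectorField (v w : GroupLieAlgebra (𝓡 6) G) (g : G) :
    mlieBracket (𝓡 6) (N.vectorField v) (N.vectorField w) (N.proj g) = N.frame ⁅v, w⁆ g := by
  rw [N.isLocalDiffeomorph.mlieBracket_of_related g
    ((N.contMDiff_vectorField v).mdifferentiableAt (by simp))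
    ((N.contMDiff_vectorField w).mdifferentiableAt (by simp))
    (N.vectorField_proj v) (N.vectorField_proj w), frame, GroupLieAlgebra.bracket_def,
    mulInvariantVector_mlieBracket]

theorem contMDiff_mvfderiv_vectorField {k : X → ℝ} (hk : ContMDiff (𝓡 6) 𝓘(ℝ, ℝ) ∞ k)
    (v : GroupLieAlgebra (𝓡 6) G) :
    ContMDiff (𝓡 6) 𝓘(ℝ, ℝ) ∞ fun x => mvfderiv (𝓡 6) k x (N.vectorField v x) := by
  have h := (hk.contMDiff_tangentMap (m := ∞) (by simp)).comp (N.contMDiff_vectorField v)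
  exact (contMDiff_snd_tangentBundle_modelSpace ℝ 𝓘(ℝ, ℝ)).comp h

section ComplexStructure

variable {N} {J : ComplexStructure X} {j : GroupLieAlgebra (𝓡 6) G → GroupLieAlgebra (𝓡 6) G}

theorem leftInvariant_sq
    (hj : ∀ v g, J.J (N.proj g) (N.frame v g) = N.frame (j v) g)
    (v : GroupLieAlgebra (𝓡 6) G) : j (j v) = -v := by
  apply N.frame_injective 1
  change N.frame (j (j v)) 1 = N.frame (-v) 1
  rw [← hj, ← hj, J.J_J, ← neg_one_smul ℝ v, frame_smul, neg_one_smul]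

theorem leftInvariant_vectorField
    (hj : ∀ v g, J.J (N.proj g) (N.frame v g) = N.frame (j v) g)
    (v : GroupLieAlgebra (𝓡 6) G) :
    (fun x => J.J x (N.vectorField v x)) = N.vectorField (j v) := funext fun x => by
  obtain ⟨g, rfl⟩ := N.surjective x
  rw [vectorField_proj, vectorField_proj, hj]

theorem leftInvariant_integrable
    (hj : ∀ v g, J.J (N.proj g) (N.frame v g) = N.frame (j v) g)
    (v w : GroupLieAlgebra (𝓡 6) G) :
    ⁅j v, j w⁆ - j ⁅j v, w⁆ - j ⁅v, j w⁆ - ⁅v, w⁆ = 0 := by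
  have h := J.integrable (N.smoothVectorField v) (N.smoothVectorField w) (N.proj 1)
  simp only [smoothVectorField, leftInvariant_vectorField hj, mlieBracket_vectorField, hj] at h
  have hsub : ∀ a b : GroupLieAlgebra (𝓡 6) G, N.frame (a - b) 1 = N.frame a 1 - N.frame b 1 :=
    fun a b => by rw [sub_eq_add_neg, frame_add, ← neg_one_smul ℝ b, frame_smul, neg_one_smul,
      sub_eq_add_neg]
  apply N.frame_injective 1
  change N.frame _ 1 = N.frame 0 1
  rw [hsub, hsub, hsub, h, ← zero_smul ℝ (0 : GroupLieAlgebra (𝓡 6) G), frame_smul, zero_smul]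

end ComplexStructure

end QuotientPresentation

end Nilmfd

/-! ### Averaging a closed 2-form over the group -/

/-- The action of a topological group by right translations on bounded continuous functions. -/
noncomputable def BoundedContinuousFunction.rightTranslation (G : Type*) [Group G]
    [TopologicalSpace G] [ContinuousMul G] : G →* ((G →ᵇ ℝ) →L[ℝ] (G →ᵇ ℝ)) where
  toFun h := LinearMap.mkContinuous
    { toFun := fun f => f.compContinuous ⟨fun g => g * h, continuous_mul_const h⟩
      map_add' := fun _ _ => rfl
      map_smul' := fun _ _ => rfl } 1 fun f => by
        rw [one_mul]
        exact (BoundedContinuousFunction.norm_le (norm_nonneg _)).2 fun g => f.norm_coe_le_norm _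
  map_one' := by
    ext f g
    simp
  map_mul' a b := by
    ext f g
    exact congrArg f (mul_assoc g a b).symm

theorem BoundedContinuousFunction.rightTranslation_apply {G : Type*} [Group G]
    [TopologicalSpace G] [ContinuousMul G] (h : G) (f : G →ᵇ ℝ) (g : G) :
    rightTranslation G h f g = f (g * h) := rfl

theorem BoundedContinuousFunction.norm_rightTranslation_le {G : Type*} [Group G]
    [TopologicalSpace G] [ContinuousMul G] (h : G) (f : G →ᵇ ℝ) :
    ‖rightTranslation G h f‖ ≤ ‖f‖ :=
  (BoundedContinuousFunction.norm_le (norm_nonneg _)).2 fun _ => f.norm_coe_le_norm _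

namespace Nilmfd

namespace QuotientPresentation

variable {G : Type*} [Group G] [TopologicalSpace G] [ChartedSpace (EuclideanSpace ℝ (Fin 6)) G]
  {X : Type*} [TopologicalSpace X] [ChartedSpace (EuclideanSpace ℝ (Fin 6)) X]
  (N : QuotientPresentation G X)

/-- The pull-back of a continuous function on the compact quotient. -/
noncomputable def pullback [CompactSpace X] (k : C(X, ℝ)) : G →ᵇ ℝ :=
  (BoundedContinuousFunction.mkOfCompact k).compContinuous
    ⟨N.proj, N.isLocalDiffeomorph.contMDiff.continuous⟩

@[simp] theorem pullback_apply [CompactSpace X] (k : C(X, ℝ)) (g : G) :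
    N.pullback k g = k (N.proj g) := rfl

variable [LieGroup (𝓡 6) ∞ G]

/-- Although G need not be compact, the difference is unchanged under left translation of g by Γ,
which commutes with right multiplication by γ(s). A compactness argument on X therefore gives a
uniform δ. -/
theorem exists_forall_abs_sub_lt [CompactSpace X] (k : C(X, ℝ)) {γ : ℝ → G}
    (hγ : Continuous γ) (h0 : γ 0 = 1) {ε : ℝ} (hε : 0 < ε) :
    ∃ δ > 0, ∀ g, ∀ s, |s| < δ → |k (N.proj (g * γ s)) - k (N.proj g)| < ε := by
  have := topologicalGroup_of_lieGroup (𝓡 6) (G := G) ∞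
  have hproj : Continuous N.proj := N.isLocalDiffeomorph.contMDiff.continuous
  have key : ∃ δ > 0, ∀ g, N.proj g ∈ (Set.univ : Set X) → ∀ s, |s| < δ →
      |k (N.proj (g * γ s)) - k (N.proj g)| < ε := by
    refine isCompact_univ.induction_on (p := fun S => ∃ δ > 0, ∀ g, N.proj g ∈ S → ∀ s, |s| < δ →
      |k (N.proj (g * γ s)) - k (N.proj g)| < ε) ⟨1, one_pos, fun g hg => hg.elim⟩
      (fun S T hST ⟨δ, hδ, h⟩ => ⟨δ, hδ, fun g hg => h g (hST hg)⟩) ?_ ?_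
    · rintro S T ⟨δ, hδ, h⟩ ⟨δ', hδ', h'⟩
      refine ⟨min δ δ', lt_min hδ hδ', fun g hg s hs => ?_⟩
      rcases hg with hg | hg
      · exact h g hg s (hs.trans_le (min_le_left _ _))
      · exact h' g hg s (hs.trans_le (min_le_right _ _))
    · intro x _
      obtain ⟨a, rfl⟩ := N.surjective x
      have hc : Continuous fun q : G × ℝ => |k (N.proj (q.1 * γ q.2)) - k (N.proj q.1)| := by
        fun_prop
      have ha : ∀ᶠ q in 𝓝 ((a, 0) : G × ℝ), |k (N.proj (q.1 * γ q.2)) - k (N.proj q.1)| < ε := by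
        refine hc.continuousAt.eventually (gt_mem_nhds ?_)
        simp [h0, hε]
      rw [nhds_prod_eq] at ha
      obtain ⟨P, hP, Q, hQ, hPQ⟩ := Filter.eventually_prod_iff.1 ha
      obtain ⟨δ, hδ, hball⟩ := Metric.eventually_nhds_iff.1 hQ
      refine ⟨N.proj '' {g | P g}, mem_nhdsWithin_of_mem_nhds
        (N.isLocalDiffeomorph.isOpenMap.image_mem_nhds hP), δ, hδ, ?_⟩
      rintro g ⟨b, hb, hbg⟩ s hs
      obtain ⟨l, hl, rfl⟩ := (N.proj_eq_iff _ _).1 hbg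
      rw [mul_assoc, N.proj_mul hl, N.proj_mul hl]
      exact hPQ hb (hball (by simpa using hs))
  obtain ⟨δ, hδ, h⟩ := key
  exact ⟨δ, hδ, fun g => h g trivial⟩

variable [IsManifold (𝓡 6) ∞ X]

/-- The derivative of a smooth function along a field of the frame. -/
noncomputable def derivative (k : X → ℝ) (hk : ContMDiff (𝓡 6) 𝓘(ℝ, ℝ) ∞ k)
    (v : GroupLieAlgebra (𝓡 6) G) : C(X, ℝ) :=
  ⟨fun x => mvfderiv (𝓡 6) k x (N.vectorField v x),
    (N.contMDiff_mvfderiv_vectorField hk v).continuous⟩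

theorem derivative_proj {k : X → ℝ} (hk : ContMDiff (𝓡 6) 𝓘(ℝ, ℝ) ∞ k)
    (v : GroupLieAlgebra (𝓡 6) G) (g : G) :
    N.derivative k hk v (N.proj g) = mvfderiv (𝓡 6) k (N.proj g) (N.frame v g) := by
  rw [derivative, ContinuousMap.coe_mk, vectorField_proj]

theorem hasDerivAt_comp_proj {k : X → ℝ} (hk : ContMDiff (𝓡 6) 𝓘(ℝ, ℝ) ∞ k)
    {v : GroupLieAlgebra (𝓡 6) G} {c : ℝ → G}
    (hc : IsMIntegralCurve c (mulInvariantVectorField v)) (t : ℝ) :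
    HasDerivAt (fun t => k (N.proj (c t))) (N.derivative k hk v (N.proj (c t))) t := by
  have h1 := (N.isLocalDiffeomorph.mdifferentiable (by simp) (c t)).hasMFDerivAt.comp t (hc t)
  have h2 := ((hk.mdifferentiable (by simp)) (N.proj (c t))).hasMFDerivAt.comp t h1
  have h3 := hasMFDerivAt_iff_hasFDerivAt.1 h2
  have h4 := HasFDerivAt.hasDerivAt (𝕜 := ℝ) (F := ℝ) h3
  refine h4.congr_deriv ?_
  rw [derivative_proj, frame]
  exact congrArg (fun z : EuclideanSpace ℝ (Fin 6) => mfderiv (𝓡 6) 𝓘(ℝ, ℝ) k (N.proj (c t))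
    (mfderiv (𝓡 6) (𝓡 6) N.proj (c t) z)) (one_smul ℝ (mulInvariantVectorField v (c t)))

/-- The function obtained from a 2-form and two fields of the frame. -/
noncomputable def coefficient (Ω : TwoForm X ℝ) (u v : GroupLieAlgebra (𝓡 6) G) : C(X, ℝ) :=
  ⟨fun x => Ω.val x (N.vectorField u x) (N.vectorField v x),
    (Ω.contMDiff_apply (N.smoothVectorField u) (N.smoothVectorField v)).continuous⟩

theorem coe_coefficient (Ω : TwoForm X ℝ) (u v : GroupLieAlgebra (𝓡 6) G) :
    ⇑(N.coefficient Ω u v) = fun x => Ω.val x (N.vectorField u x) (N.vectorField v x) := rfl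

theorem coefficient_proj (Ω : TwoForm X ℝ) (u v : GroupLieAlgebra (𝓡 6) G) (g : G) :
    N.coefficient Ω u v (N.proj g) = Ω.val (N.proj g) (N.frame u g) (N.frame v g) := by
  simp only [coe_coefficient, vectorField_proj]

variable [CompactSpace X]

/-- The derivative along v is the uniform limit of difference quotients of right translates along
the one-parameter subgroup of v, and an invariant functional kills each quotient. -/
theorem invariant_functional_derivative [T2Space G] [ContinuousMul G] {φ : (G →ᵇ ℝ) →L[ℝ] ℝ}
    (hφ : ∀ g f, φ (BoundedContinuousFunction.rightTranslation G g f) = φ f)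
    (k : C(X, ℝ)) (hk : ContMDiff (𝓡 6) 𝓘(ℝ, ℝ) ∞ k)
    (v : GroupLieAlgebra (𝓡 6) G) : φ (N.pullback (N.derivative k hk v)) = 0 := by
  obtain ⟨γ, h0, -, hγ, hs⟩ := LieGroup.exists_oneParameterSubgroup v
  set D := N.derivative k hk v
  have hbound : ∀ ε > 0, |φ (N.pullback D)| ≤ ‖φ‖ * ε := by
    intro ε hε
    obtain ⟨δ, hδ, h⟩ := N.exists_forall_abs_sub_lt D hs.continuous h0 hε
    have hδ2 : 0 < δ / 2 := half_pos hδ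
    have h1 : ‖BoundedContinuousFunction.rightTranslation G (γ (δ / 2)) (N.pullback k) -
        N.pullback k - (δ / 2) • N.pullback D‖ ≤ ε * (δ / 2) := by
      refine (BoundedContinuousFunction.norm_le (by positivity)).2 fun g => ?_
      have h2 : ∀ t ∈ Set.Icc 0 (δ / 2), HasDerivWithinAt
          (fun t => k (N.proj (g * γ t)) - t * D (N.proj g))
          (D (N.proj (g * γ t)) - D (N.proj g)) (Set.Icc 0 (δ / 2)) t := fun t _ =>
        ((N.hasDerivAt_comp_proj hk (hγ g) t).sub
          ((hasDerivAt_id t).mul_const _)).hasDerivWithinAt.congr_deriv (by simp [D])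
      have h3 := norm_image_sub_le_of_norm_deriv_le_segment' h2
        (fun t ht => (h g t (by rw [abs_of_nonneg ht.1]; linarith [ht.2])).le) (δ / 2)
        ⟨hδ2.le, le_rfl⟩
      simpa [BoundedContinuousFunction.rightTranslation_apply, h0, sub_right_comm] using h3
    have h4 := (φ.le_opNorm _).trans (mul_le_mul_of_nonneg_left h1 (norm_nonneg φ))
    rw [map_sub, map_sub, hφ, sub_self, zero_sub, map_smul, norm_neg, norm_smul,
      Real.norm_of_nonneg hδ2.le, ← mul_assoc, mul_comm] at h4
    exact le_of_mul_le_mul_right h4 hδ2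
  by_contra hne
  have h1 : 0 < |φ (N.pullback D)| := abs_pos.2 hne
  have h2 := hbound (|φ (N.pullback D)| / (2 * (‖φ‖ + 1))) (by positivity)
  have h3 : ‖φ‖ * (|φ (N.pullback D)| / (2 * (‖φ‖ + 1))) < |φ (N.pullback D)| := by
    rw [← mul_div_assoc, div_lt_iff₀ (by positivity)]
    nlinarith [norm_nonneg φ]
  exact absurd h2 h3.not_ge

/-- The average of a 2-form by a functional on the bounded continuous functions on the group. -/
noncomputable def average (φ : (G →ᵇ ℝ) →L[ℝ] ℝ) (Ω : TwoForm X ℝ) :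
    GroupLieAlgebra (𝓡 6) G →ₗ[ℝ] GroupLieAlgebra (𝓡 6) G →ₗ[ℝ] ℝ :=
  LinearMap.mk₂ ℝ (fun u v => φ (N.pullback (N.coefficient Ω u v)))
    (fun u u' v => by
      rw [← map_add]
      congr 1
      ext g
      simp [coefficient_proj, frame_add])
    (fun c u v => by
      rw [← map_smul]
      congr 1
      ext g
      simp [coefficient_proj, frame_smul])
    (fun u v v' => by
      rw [← map_add]
      congr 1
      ext g
      simp [coefficient_proj, frame_add])
    (fun c u v => by
      rw [← map_smul]
      congr 1
      ext g
      simp [coefficient_proj, frame_smul])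

theorem average_apply (φ : (G →ᵇ ℝ) →L[ℝ] ℝ) (Ω : TwoForm X ℝ) (u v : GroupLieAlgebra (𝓡 6) G) :
    N.average φ Ω u v = φ (N.pullback (N.coefficient Ω u v)) := rfl

theorem average_self (φ : (G →ᵇ ℝ) →L[ℝ] ℝ) (Ω : TwoForm X ℝ) (v : GroupLieAlgebra (𝓡 6) G) :
    N.average φ Ω v v = 0 := by
  rw [average_apply, ← map_zero φ]
  congr 1
  ext g
  simp [coefficient_proj, Ω.alternating]

theorem average_closed [T2Space G] [ContinuousMul G] {φ : (G →ᵇ ℝ) →L[ℝ] ℝ}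
    (hφ : ∀ g f, φ (BoundedContinuousFunction.rightTranslation G g f) = φ f)
    {Ω : TwoForm X ℝ} (hΩ : Ω.IsClosed) (u v w : GroupLieAlgebra (𝓡 6) G) :
    N.average φ Ω ⁅u, v⁆ w - N.average φ Ω ⁅u, w⁆ v + N.average φ Ω ⁅v, w⁆ u = 0 := by
  have hs : ∀ a b, ContMDiff (𝓡 6) 𝓘(ℝ, ℝ) ∞ (N.coefficient Ω a b) := fun a b =>
    Ω.contMDiff_apply (N.smoothVectorField a) (N.smoothVectorField b)
  have h : N.pullback (N.coefficient Ω ⁅u, v⁆ w) - N.pullback (N.coefficient Ω ⁅u, w⁆ v) +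
      N.pullback (N.coefficient Ω ⁅v, w⁆ u) =
      N.pullback (N.derivative _ (hs v w) u) - N.pullback (N.derivative _ (hs u w) v) +
        N.pullback (N.derivative _ (hs u v) w) := by
    ext g
    have h1 := hΩ (N.smoothVectorField u) (N.smoothVectorField v) (N.smoothVectorField w)
      (N.proj g)
    simp only [TwoForm.d, smoothVectorField, mlieBracket_vectorField] at h1
    simp only [BoundedContinuousFunction.coe_add, BoundedContinuousFunction.coe_sub,
      Pi.add_apply, Pi.sub_apply, pullback_apply, coefficient_proj, derivative_proj,
      coe_coefficient]
    simp only [vectorField_proj] at h1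
    linarith
  simp only [average_apply]
  rw [← map_sub, ← map_add, h, map_add, map_sub, N.invariant_functional_derivative hφ,
    N.invariant_functional_derivative hφ, N.invariant_functional_derivative hφ]
  simp

/-- A nilpotent group with a left-invariant complex structure and a left-invariant
Hermitian-symplectic metric on its compact quotient has a commutative Lie algebra. -/
theorem lie_eq_zero [T2Space G] [Group.IsNilpotent G] {J : ComplexStructure X}
    (hJ : N.LeftInvariant J) {h : HermitianMetric J} (hinv : N.LeftInvariantMetric h)
    (hh : h.IsHermitianSymplectic) (v w : GroupLieAlgebra (𝓡 6) G) : ⁅v, w⁆ = 0 := by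
  have := topologicalGroup_of_lieGroup (𝓡 6) (G := G) ∞
  have : LieRing.IsNilpotent (GroupLieAlgebra (𝓡 6) G) := LieGroup.isNilpotent_groupLieAlgebra
  obtain ⟨Ω, hΩ, -, hcomp⟩ := hh
  obtain ⟨j, hj⟩ := hJ
  obtain ⟨φ, hφ1, hφ⟩ := exists_invariant_functional_of_isNilpotent
    (BoundedContinuousFunction.rightTranslation G)
    BoundedContinuousFunction.norm_rightTranslation_le (1 : G →ᵇ ℝ)
    (fun h => one_ne_zero (α := ℝ) (congrArg (fun f : G →ᵇ ℝ => f 1) h))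
    (fun _ => rfl)
  refine LieAlgebra.lie_eq_zero_of_taming j (leftInvariant_sq hj) (leftInvariant_integrable hj)
    (N.average φ Ω) (N.average_self φ Ω) (N.average_closed hφ hΩ) (fun v hv => ?_) v w
  -- Invariance of the metric enters here: Ω(v, jv) = g(jv, jv) is constant, so its mean is that
  -- constant.
  have h1 : N.pullback (N.coefficient Ω v (j v)) =
      (h.metric.inner (N.proj 1) (N.frame (j v) 1) (N.frame (j v) 1)) • (1 : G →ᵇ ℝ) := by
    ext g
    have := h.apply_J_of_component11 hcomp (N.proj g) (N.frame v g)
    rw [hj, hinv] at this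
    simp [coefficient_proj, this]
  rw [average_apply, h1, map_smul, hφ1, smul_eq_mul, mul_one]
  refine h.metric.pos _ _ fun h0 => hv ?_
  have hz : j v = 0 := N.frame_injective 1 (by
    change N.frame (j v) 1 = N.frame 0 1
    rw [h0, ← zero_smul ℝ (0 : GroupLieAlgebra (𝓡 6) G), frame_smul, zero_smul])
  have hz' : j 0 = 0 := N.frame_injective 1 (by
    have h2 : N.frame (0 : GroupLieAlgebra (𝓡 6) G) 1 = 0 := by
      rw [← zero_smul ℝ (0 : GroupLieAlgebra (𝓡 6) G), frame_smul, zero_smul]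
    change N.frame (j 0) 1 = N.frame 0 1
    rw [← hj, h2, map_zero])
  rw [← neg_eq_zero, ← leftInvariant_sq hj v, hz, hz']

end QuotientPresentation

end Nilmfd

/-! ### Commutative groups and tori -/

theorem ContMDiff.isLocalDiffeomorphAt_of_hasMFDerivAt {E : Type*} [NormedAddCommGroup E]
    [NormedSpace ℝ E] [CompleteSpace E] {M : Type*} [TopologicalSpace M] [ChartedSpace E M]
    [IsManifold 𝓘(ℝ, E) ∞ M] {f : E → M} (hf : ContMDiff 𝓘(ℝ, E) 𝓘(ℝ, E) ∞ f) {a : E}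
    (L : E ≃L[ℝ] E) (hL : HasMFDerivAt 𝓘(ℝ, E) 𝓘(ℝ, E) f a (L : E →L[ℝ] E)) :
    IsLocalDiffeomorphAt 𝓘(ℝ, E) 𝓘(ℝ, E) ∞ f a := by
  set c := chartAt E (f a) with hc
  have hF : ∀ x, f x ∈ c.source → ContDiffAt ℝ ∞ (fun y => c (f y)) x := fun x hx => by
    have h1 : ContMDiffAt 𝓘(ℝ, E) 𝓘(ℝ, E) ∞ (extChartAt 𝓘(ℝ, E) (f a)) (f x) :=
      contMDiffAt_extChartAt' hx
    exact (h1.comp x hf.contMDiffAt).contDiffAt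
  have ha : f a ∈ c.source := mem_chart_source E (f a)
  have hd : HasFDerivAt (fun y => c (f y)) (L : E →L[ℝ] E) a := by
    have : HasFDerivWithinAt (fun y => c (f y)) (L : E →L[ℝ] E) (Set.range id) a := hL.2
    rwa [Set.range_id, hasFDerivWithinAt_univ] at this
  set e := (hF a ha).toOpenPartialHomeomorph (fun y => c (f y)) hd (by simp) with he
  -- The inverse function theorem gives smoothness of the inverse only at the image of a; shrinking
  -- to where the derivative stays invertible gives it throughout.
  have hnear : ∀ᶠ x in 𝓝 a, f x ∈ c.source ∧
      fderiv ℝ (fun y => c (f y)) x ∈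
        Set.range (ContinuousLinearEquiv.toContinuousLinearMap : (E ≃L[ℝ] E) → (E →L[ℝ] E)) := by
    refine (hf.continuous.continuousAt.eventually (c.open_source.mem_nhds ha)).and ?_
    have h1 := ((hF a ha).fderiv_right (m := 0) (by simp)).continuousAt
    refine h1.eventually ?_
    rw [hd.fderiv]
    exact L.nhds
  obtain ⟨U, hU, hUo, haU⟩ := eventually_nhds_iff.1 hnear
  set e' := (e.restrOpen U hUo).trans c.symm with he'
  have hsource : ∀ x, x ∈ e'.source → x ∈ e.source ∧ x ∈ U := fun x hx => by
    simp only [he', OpenPartialHomeomorph.trans_source,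
      OpenPartialHomeomorph.restrOpen_source] at hx
    exact hx.1
  have hfe : ∀ x ∈ e'.source, e' x = f x := fun x hx => c.left_inv (hU x (hsource x hx).2).1
  refine ⟨⟨e'.toPartialEquiv, e'.open_source, e'.open_target, ?_, ?_⟩, ?_, ?_⟩
  · exact hf.contMDiffOn.congr hfe
  · intro y hy
    have hx := e'.map_target hy
    set x := e'.symm y with hxdef
    have h1 : ContMDiffAt 𝓘(ℝ, E) 𝓘(ℝ, E) ∞ c y := by
      have : y ∈ c.source := by
        simp only [he', OpenPartialHomeomorph.trans_target] at hy
        exact hy.1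
      exact contMDiffAt_extChartAt' this
    have h2 : ContDiffAt ℝ ∞ e.symm (c y) := by
      obtain ⟨L', hL'⟩ := (hU x (hsource x hx).2).2
      have hxe : e.symm (c y) = x := rfl
      refine e.contDiffAt_symm (f₀' := L') ?_ ?_ ?_
      · simp only [he', OpenPartialHomeomorph.trans_target] at hy
        have := hy.2
        exact this.1
      · rw [hxe, hL']
        exact ((hF x (hU x (hsource x hx).2).1).differentiableAt (by simp)).hasFDerivAt
      · rw [hxe]
        exact hF x (hU x (hsource x hx).2).1
    exact (h2.contMDiffAt.comp y h1).contMDiffWithinAt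
  · change a ∈ e'.source
    simp only [he', OpenPartialHomeomorph.trans_source, OpenPartialHomeomorph.restrOpen_source]
    refine ⟨⟨(hF a ha).mem_toOpenPartialHomeomorph_source hd (by simp), haU⟩, ?_⟩
    exact c.map_source ha
  · exact fun x hx => (hfe x hx).symm

namespace LieGroup

variable {E : Type*} [NormedAddCommGroup E] [NormedSpace ℝ E] [FiniteDimensional ℝ E]
  {G : Type*} [CommGroup G] [TopologicalSpace G] [ChartedSpace E G] [LieGroup 𝓘(ℝ, E) ∞ G]

variable (E G) in
/-- The exponential map of a commutative Lie group. -/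
theorem exists_exponential [T2Space G] :
    ∃ Φ : E → G, (∀ s t, Φ (s + t) = Φ s * Φ t) ∧ ContMDiff 𝓘(ℝ, E) 𝓘(ℝ, E) ∞ Φ ∧
      HasMFDerivAt 𝓘(ℝ, E) 𝓘(ℝ, E) Φ 0 (ContinuousLinearMap.id ℝ E) := by
  have := FiniteDimensional.complete ℝ E
  let b := Module.finBasis ℝ E
  choose γ h0 hadd hγ hs using fun i =>
    exists_oneParameterSubgroup (G := G) (show GroupLieAlgebra 𝓘(ℝ, E) G from b i)
  -- Commutativity makes this product of one-parameter subgroups a homomorphism.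
  set Φ : E → G := fun t => ∏ i, γ i (b.coord i t) with hΦ
  have hsm : ContMDiff 𝓘(ℝ, E) 𝓘(ℝ, E) ∞ Φ := by
    refine contMDiff_finsetProd fun i _ => (hs i).comp ?_
    exact (LinearMap.toContinuousLinearMap (b.coord i)).contMDiff
  refine ⟨Φ, fun s t => ?_, hsm, ?_⟩
  · simp only [hΦ, map_add, hadd, Finset.prod_mul_distrib]
  have h1 := ((hsm.mdifferentiable (by simp)) 0).hasMFDerivAt
  refine h1.congr_mfderiv ?_
  have h2 : ∀ i, (mfderiv 𝓘(ℝ, E) 𝓘(ℝ, E) Φ 0 : E →L[ℝ] E) (b i) = b i := fun i => by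
    have h3 : ∀ y : E, y = 0 → HasMFDerivAt 𝓘(ℝ, E) 𝓘(ℝ, E) Φ y
        (mfderiv 𝓘(ℝ, E) 𝓘(ℝ, E) Φ 0 : E →L[ℝ] E) := by
      rintro _ rfl; exact h1
    have h4 : HasMFDerivAt 𝓘(ℝ, ℝ) 𝓘(ℝ, E) (fun t : ℝ => t • b i) 0
        ((1 : ℝ →L[ℝ] ℝ).smulRight (b i)) :=
      ((hasDerivAt_id (0 : ℝ)).smul_const (b i)).hasFDerivAt.hasMFDerivAt.congr_mfderiv
        (by ext1; change (1 : ℝ) • (1 : ℝ) • b i = (1 : ℝ) • b i; rw [one_smul])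
    have h5 := (h3 _ (zero_smul ℝ (b i))).comp (0 : ℝ) h4
    have h6 : Φ ∘ (fun t : ℝ => t • b i) = fun t => 1 * γ i t := by
      funext t
      simp only [Function.comp, hΦ, one_mul]
      rw [Finset.prod_eq_single i]
      · simp
      · intro j _ hj
        simp [Finsupp.single_eq_of_ne hj, h0]
      · simp
    rw [h6] at h5
    have h7 := (hγ i 1 0)
    have h8 := hasMFDerivAt_unique h5 h7
    have h9 := congrArg (fun T : ℝ →L[ℝ] E => T 1) h8
    have h10 := mulInvariantVectorField_eq_self (E := E) (G := G) (b i) (k := 1 * γ i 0)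
      (by rw [h0, one_mul])
    refine Eq.trans (congrArg (mfderiv 𝓘(ℝ, E) 𝓘(ℝ, E) Φ 0 : E →L[ℝ] E)
      (one_smul ℝ (b i)).symm) (h9.trans ?_)
    exact (one_smul ℝ (mulInvariantVectorField (I := 𝓘(ℝ, E)) (b i) (1 * γ i 0) : E)).trans h10
  let D : E →L[ℝ] E := mfderiv 𝓘(ℝ, E) 𝓘(ℝ, E) Φ 0
  have h11 : (D : E →ₗ[ℝ] E) = (ContinuousLinearMap.id ℝ E : E →ₗ[ℝ] E) := b.ext h2
  exact ContinuousLinearMap.coe_injective h11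

variable (E) in
/-- Left translation as a diffeomorphism. -/
noncomputable def mulLeftDiffeomorph (a : G) : Diffeomorph 𝓘(ℝ, E) 𝓘(ℝ, E) G G ∞ where
  toEquiv := Equiv.mulLeft a
  contMDiff_toFun := contMDiff_mul_left
  contMDiff_invFun := contMDiff_mul_left (a := a⁻¹)

theorem exists_isLocalDiffeomorph_exponential [T2Space G] [PreconnectedSpace G] :
    ∃ Φ : E → G, (∀ s t, Φ (s + t) = Φ s * Φ t) ∧
      IsLocalDiffeomorph 𝓘(ℝ, E) 𝓘(ℝ, E) ∞ Φ ∧ Function.Surjective Φ := by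
  have := FiniteDimensional.complete ℝ E
  have := topologicalGroup_of_lieGroup 𝓘(ℝ, E) (G := G) ∞
  obtain ⟨Φ, hadd, hsm, hd⟩ := exists_exponential E G
  have hloc0 : IsLocalDiffeomorphAt 𝓘(ℝ, E) 𝓘(ℝ, E) ∞ Φ 0 :=
    hsm.isLocalDiffeomorphAt_of_hasMFDerivAt (ContinuousLinearEquiv.refl ℝ E) hd
  have hloc : IsLocalDiffeomorph 𝓘(ℝ, E) 𝓘(ℝ, E) ∞ Φ := fun a => by
    let T : Diffeomorph 𝓘(ℝ, E) 𝓘(ℝ, E) E E ∞ :=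
      { toEquiv := Equiv.addLeft (-a)
        contMDiff_toFun := contMDiff_const.add contMDiff_id
        contMDiff_invFun := (contMDiff_const (c := - -a)).add contMDiff_id }
    have h1 : IsLocalDiffeomorphAt 𝓘(ℝ, E) 𝓘(ℝ, E) ∞ Φ (T a) := by
      have : T a = 0 := neg_add_cancel a
      rw [this]; exact hloc0
    have h2 := (IsLocalDiffeomorphAt.comp 𝓘(ℝ, E) G (T.isLocalDiffeomorph a) h1).comp 𝓘(ℝ, E) G
      ((mulLeftDiffeomorph E (Φ a)).isLocalDiffeomorph _)
    have h3 : (mulLeftDiffeomorph E (Φ a)) ∘ Φ ∘ T = Φ := funext fun x => by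
      change Φ a * Φ (-a + x) = Φ x
      rw [← hadd, add_neg_cancel_left]
    rwa [← h3]
  refine ⟨Φ, hadd, hloc, ?_⟩
  have h0 : Φ 0 = 1 := by simpa using hadd 0 0
  let H : Subgroup G :=
    { carrier := Set.range Φ
      one_mem' := ⟨0, h0⟩
      mul_mem' := by
        rintro _ _ ⟨s, rfl⟩ ⟨t, rfl⟩
        exact ⟨s + t, hadd s t⟩
      inv_mem' := by
        rintro _ ⟨s, rfl⟩
        exact ⟨-s, eq_inv_of_mul_eq_one_left (by rw [← hadd, neg_add_cancel, h0])⟩ }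
  have hopen : IsOpen (H : Set G) := hloc.isOpen_range
  -- The image is an open subgroup, hence closed, hence everything by connectedness.
  have huniv := IsClopen.eq_univ ⟨H.isClosed_of_isOpen hopen, hopen⟩ ⟨1, H.one_mem⟩
  exact Set.range_eq_univ.1 huniv

end LieGroup

/-- If L did not span, a nonzero linear functional vanishing on L would descend to an unbounded
continuous function on the compact space X. -/
theorem IsLocalDiffeomorph.span_fiber_eq_top {E : Type*} [NormedAddCommGroup E]
    [NormedSpace ℝ E] [FiniteDimensional ℝ E] {X : Type*} [TopologicalSpace X] [CompactSpace X]
    [ChartedSpace E X] {p : E → X} (hp : IsLocalDiffeomorph 𝓘(ℝ, E) 𝓘(ℝ, E) ∞ p)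
    (hsurj : Function.Surjective p) (L : AddSubgroup E) (hL : ∀ s t, p s = p t → t - s ∈ L) :
    Submodule.span ℝ (L : Set E) = ⊤ := by
  by_contra hne
  obtain ⟨x, hx⟩ : ∃ x, x ∉ Submodule.span ℝ (L : Set E) := by
    by_contra! h
    exact hne (eq_top_iff.2 fun x _ => h x)
  obtain ⟨l, hl1, hl2⟩ :=
    Submodule.exists_dual_map_eq_bot_of_notMem (R := ℝ) (M := E) hx inferInstance
  have hzero : ∀ y ∈ L, l y = 0 := fun y hy => by
    rw [← Submodule.mem_bot ℝ, ← hl2]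
    exact Submodule.mem_map_of_mem (Submodule.subset_span hy)
  let f : X → ℝ := fun y => l (Function.surjInv hsurj y)
  have hf : ∀ t, f (p t) = l t := fun t => by
    have := hzero _ (hL (Function.surjInv hsurj (p t)) t (Function.surjInv_eq hsurj _))
    rw [map_sub, sub_eq_zero] at this
    exact this.symm
  have hcont : Continuous f := by
    rw [(hp.isOpenMap.isQuotientMap hp.contMDiff.continuous hsurj).continuous_iff]
    rw [show f ∘ p = l from funext hf]
    exact l.continuous_of_finiteDimensional
  obtain ⟨C, hC⟩ := (isCompact_range hcont).bddAbove
  have h1 := hC ⟨p (((C + 1) / l x) • x), rfl⟩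
  rw [hf, map_smul, smul_eq_mul, div_mul_cancel₀ _ hl1] at h1
  linarith

theorem IsLocalDiffeomorphAt.exists_isOpen_injOn {E : Type*} [NormedAddCommGroup E]
    [NormedSpace ℝ E] {M X : Type*} [TopologicalSpace M] [ChartedSpace E M] [TopologicalSpace X]
    [ChartedSpace E X] {p : M → X} {a : M} (hp : IsLocalDiffeomorphAt 𝓘(ℝ, E) 𝓘(ℝ, E) ∞ p a) :
    ∃ U, IsOpen U ∧ a ∈ U ∧ Set.InjOn p U := by
  obtain ⟨Ψ, ha, h⟩ := hp
  exact ⟨Ψ.source, Ψ.open_source, ha, fun x hx y hy hxy =>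
    Ψ.injOn hx hy (by rw [h hx, h hy] at hxy; exact hxy)⟩

theorem IsLocalDiffeomorph.exists_equiv_fiber_eq_integers {E : Type*} [NormedAddCommGroup E]
    [NormedSpace ℝ E] [FiniteDimensional ℝ E] {X : Type*} [TopologicalSpace X] [CompactSpace X]
    [ChartedSpace E X] {p : E → X} (hp : IsLocalDiffeomorph 𝓘(ℝ, E) 𝓘(ℝ, E) ∞ p)
    (hsurj : Function.Surjective p) (L : AddSubgroup E)
    (hL : ∀ s t, p s = p t ↔ t - s ∈ L) {n : ℕ} (hn : Module.finrank ℝ E = n) :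
    ∃ b : Module.Basis (Fin n) ℝ E, ∀ t, t ∈ L ↔ ∀ i, ∃ k : ℤ, b.repr t i = k := by
  have : ProperSpace E := FiniteDimensional.proper ℝ E
  let Λ : Submodule ℤ E := AddSubgroup.toIntSubmodule L
  -- The map p is injective near 0 and constant on L, so 0 is isolated in L.
  have hdisc : DiscreteTopology Λ := by
    refine discreteTopology_of_isOpen_singleton_zero ?_
    obtain ⟨U, hU, h0, hinj⟩ := (hp 0).exists_isOpen_injOn
    have : ({0} : Set Λ) = Subtype.val ⁻¹' U := by
      ext x
      refine ⟨fun hx => ?_, fun hx => ?_⟩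
      · rw [Set.mem_singleton_iff] at hx
        subst hx
        exact h0
      · refine Subtype.ext (hinj hx h0 ?_)
        rw [eq_comm, hL, ZeroMemClass.coe_zero, sub_zero]
        exact x.2
    rw [this]
    exact hU.preimage continuous_subtype_val
  have hlat : IsZLattice ℝ Λ := ⟨hp.span_fiber_eq_top hsurj L fun s t h => (hL s t).1 h⟩
  have := ZLattice.module_free ℝ Λ
  have := ZLattice.module_finite ℝ Λ
  let b := Module.finBasisOfFinrankEq ℤ Λ ((ZLattice.rank ℝ Λ).trans hn)
  refine ⟨b.ofZLatticeBasis ℝ Λ, fun t => ?_⟩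
  have h1 : t ∈ L ↔ t ∈ Submodule.span ℤ (Set.range (b.ofZLatticeBasis ℝ Λ)) := by
    rw [b.ofZLatticeBasis_span ℝ Λ]; rfl
  rw [h1, Module.Basis.mem_span_iff_repr_mem]
  simp [Set.mem_range, eq_comm]

namespace Nilmfd

theorem QuotientPresentation.isTorus_of_commGroup {G : Type*} [CommGroup G] [TopologicalSpace G]
    [T2Space G] [PreconnectedSpace G] [ChartedSpace (EuclideanSpace ℝ (Fin 6)) G]
    [LieGroup (𝓡 6) ∞ G] {X : Type*} [TopologicalSpace X] [CompactSpace X]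
    [ChartedSpace (EuclideanSpace ℝ (Fin 6)) X] (N : QuotientPresentation G X) : IsTorus X := by
  obtain ⟨Φ, hadd, hloc, hsurj⟩ :=
    LieGroup.exists_isLocalDiffeomorph_exponential (E := EuclideanSpace ℝ (Fin 6)) (G := G)
  have h0 : Φ 0 = 1 := by simpa using hadd 0 0
  have hneg : ∀ t, Φ (-t) = (Φ t)⁻¹ := fun t =>
    eq_inv_of_mul_eq_one_left (by rw [← hadd, neg_add_cancel, h0])
  let L : AddSubgroup (EuclideanSpace ℝ (Fin 6)) :=
    { carrier := {t | Φ t ∈ N.lattice}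
      zero_mem' := by
        change Φ 0 ∈ N.lattice
        rw [h0]; exact N.lattice.one_mem
      add_mem' := fun {s t} hs ht => by
        change Φ (s + t) ∈ N.lattice
        rw [hadd]; exact N.lattice.mul_mem hs ht
      neg_mem' := fun {t} ht => by
        change Φ (-t) ∈ N.lattice
        rw [hneg]; exact N.lattice.inv_mem ht }
  have hp : IsLocalDiffeomorph (𝓡 6) (𝓡 6) ∞ (N.proj ∘ Φ) := fun t =>
    IsLocalDiffeomorphAt.comp (𝓡 6) X (hloc t) (N.isLocalDiffeomorph (Φ t))
  have hL : ∀ s t, (N.proj ∘ Φ) s = (N.proj ∘ Φ) t ↔ t - s ∈ L := fun s t => by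
    change N.proj (Φ s) = N.proj (Φ t) ↔ Φ (t - s) ∈ N.lattice
    rw [N.proj_eq_iff, sub_eq_add_neg, hadd, hneg]
    constructor
    · rintro ⟨γ, hγ, h⟩
      rwa [h, mul_inv_cancel_right]
    · exact fun h => ⟨_, h, by rw [inv_mul_cancel_right]⟩
  obtain ⟨b, hb⟩ := hp.exists_equiv_fiber_eq_integers (N.surjective.comp hsurj) L hL
    (n := 6) (by simp)
  -- A linear change of coordinates taking ℤ⁶ to the lattice Φ⁻¹(Γ).
  let A : EuclideanSpace ℝ (Fin 6) ≃L[ℝ] EuclideanSpace ℝ (Fin 6) :=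
    (EuclideanSpace.equiv (Fin 6) ℝ).trans b.equivFunL.symm
  refine ⟨N.proj ∘ Φ ∘ A, fun x => ?_, (N.surjective.comp hsurj).comp A.surjective, fun x y => ?_⟩
  · exact IsLocalDiffeomorphAt.comp (𝓡 6) X (A.toDiffeomorph.isLocalDiffeomorph x) (hp (A x))
  · have h1 : ∀ z i, b.repr (A z) i = z i := fun z i => by
      change b.equivFun (b.equivFun.symm z) i = z i
      rw [LinearEquiv.apply_symm_apply]
    refine (hL (A x) (A y)).trans ?_
    rw [← map_sub, hb]
    simp only [h1, PiLp.sub_apply, sub_eq_iff_eq_add']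

end Nilmfd

/-! ### The main theorem -/

theorem mainTheorem2
    {G : Type*} [Group G] [TopologicalSpace G] [T2Space G]
    [ChartedSpace (EuclideanSpace ℝ (Fin 6)) G] [LieGroup (𝓡 6) ∞ G]
    [SimplyConnectedSpace G] [Group.IsNilpotent G]
    {X : Type*} [TopologicalSpace X] [T2Space X] [CompactSpace X]
    [ChartedSpace (EuclideanSpace ℝ (Fin 6)) X] [IsManifold (𝓡 6) ∞ X]
    (N : Nilmfd.QuotientPresentation G X) (hX : ¬ Nilmfd.IsTorus X)
    (J : Nilmfd.ComplexStructure X) (hJ : N.LeftInvariant J) :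
    (¬ ∃ g : Nilmfd.HermitianMetric J, N.LeftInvariantMetric g ∧ g.IsComponentOfClosed) ∧
      ∀ g : Nilmfd.HermitianMetric J, g.IsComponentOfClosed ↔ g.IsHermitianSymplectic := by
  refine ⟨?_, fun g => g.isComponentOfClosed_iff⟩
  rintro ⟨g, hinv, hg⟩
  have hcomm := LieGroup.commute_of_bracket_eq_zero
    (N.lie_eq_zero hJ hinv (g.isComponentOfClosed_iff.1 hg))
  let _ : CommGroup G := { ‹Group G› with mul_comm := hcomm }
  exact hX N.isTorus_of_commGroup
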